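/- Write $\dim_H$, $\dim_B$ and $\dim_P$ for Hausdorff, box counting and packing dimension; an equality $\dim_B X=t$ means that the lower and the upper box counting dimension of $X$ are both equal to $t$. A square is nondegenerate and has axes-parallel sides, so that the vertices of a square centred at $(x,y)$ are the points $(x\pm r,y\pm r)$ for some $r>0$. For $k=1,2,\dots$ let $$D_k=\{a+bk+ck^2+dk^3 : a,b,c,d\in\{-k+1,-k+2,\dots,2k-2\},\ abcd=0\}.$$ Call a set $A\subset\mathbb R$ a $D$-sumset if there are $t_k>0$ with $\sum_k t_k k^4<\infty$ such that $A=\{\sum_{k=1}^\infty t_k a_k : a_k\in D_k\}$. (a) For every $s\in[0,2]$ there are compact sets $S,B\subset\mathbb R^2$ such that $\dim_H S=\dim_B S=\dim_P S=s$, $\dim_P B=\dim_B B=\frac{3s}{4}$, and every point of $S$ is the center of a square with all four vertices in $B$. (b) There is a compact set $B\subset\mathbb R^2$ such that $\dim_P B=\dim_B B=\frac32$ and every point of $[0,1]\times[0,1]$ is the center of a square with all four vertices in $B$. (c) For every $s\in[0,2]$ there are compact sets $A\subset\mathbb R$ and $S\subset\mathbb R^2$ such that $\dim_H S=\dim_B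 S=\dim_P S=s$, $\dim_B A=\dim_P A=\frac{3s}{8}$, and for every $(x,y)\in S$ there is $r>0$ with $x-r,\,x+r,\,y-r,\,y+r\in A$. (d) There is a compact set $A\subset\mathbb R$ such that $\dim_B A=\dim_P A=\frac34$ and for every $(x,y)\in[0,1]\times[0,1]$ there is $r>0$ with $x-r,\,x+r,\,y-r,\,y+r\in A$. Moreover, the sets $A$ in (c) and (d) can be taken to be $D$-sumsets, and the sets $B$ in (a) and (b) can be taken of the form $A\times A$ with $A$ a $D$-sumset. -/

import Mathlib

open Set Filter Topology
open scoped ENNReal NNReal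

noncomputable section

/-- The Euclidean plane. -/
abbrev Plane : Type := EuclideanSpace ℝ (Fin 2)

/-- The smallest number of sets of diameter at most `δ` that cover `A` (`⊤` if there is no finite
such cover). -/
def coverNumber {X : Type*} [MetricSpace X] (A : Set X) (δ : ℝ) : ℕ∞ :=
  ⨅ (cov : Set (Set X)) (_ : A ⊆ ⋃₀ cov) (_ : ∀ U ∈ cov, Metric.ediam U ≤ ENNReal.ofReal δ), cov.encard

/-- The quotient `log N_δ(A) / (-log δ)` whose lower and upper limits as `δ → 0+` are the box
dimensions. -/
def boxQuotient {X : Type*} [MetricSpace X] (A : Set X) (δ : ℝ) : EReal :=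
  ENNReal.log ((coverNumber A δ : ℕ∞) : ℝ≥0∞) / ((-Real.log δ : ℝ) : EReal)

/-- Lower box counting dimension (for non-empty bounded `A`; it is `⊥` for the empty set, and `⊤`
for unbounded sets). -/
def lowerBoxDim {X : Type*} [MetricSpace X] (A : Set X) : EReal :=
  liminf (boxQuotient A) (𝓝[>] (0 : ℝ))

/-- Upper box counting dimension (with the same conventions). -/
def upperBoxDim {X : Type*} [MetricSpace X] (A : Set X) : EReal :=
  limsup (boxQuotient A) (𝓝[>] (0 : ℝ))

/-- The box dimension of `A` exists and equals `t`. -/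
def HasBoxDim {X : Type*} [MetricSpace X] (A : Set X) (t : ℝ) : Prop :=
  lowerBoxDim A = (t : EReal) ∧ upperBoxDim A = (t : EReal)

/-- A `δ`-packing of `F`: a countable family of pairwise disjoint closed balls with centres in `F`
and positive radii at most `δ`; a ball is recorded as the pair (centre, radius). -/
def IsPacking {X : Type*} [MetricSpace X] (F : Set X) (δ : ℝ) (P : Set (X × ℝ)) : Prop :=
  P.Countable ∧ (∀ p ∈ P, p.1 ∈ F ∧ 0 < p.2 ∧ p.2 ≤ δ) ∧
    P.PairwiseDisjoint (fun p => Metric.closedBall p.1 p.2)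

/-- The packing premeasure `P₀^d(F) = lim_{δ → 0+} sup ∑ |B_i|^d`, the supremum over all
`δ`-packings `(B_i)` of `F`. A ball of radius `r` counts as having diameter `2 r`, which is the case
in `ℝⁿ`, `n ≥ 1`. The supremum is monotone in `δ`, so that the limit is an infimum. -/
def packingPremeasure {X : Type*} [MetricSpace X] (d : ℝ≥0) (F : Set X) : ℝ≥0∞ :=
  ⨅ (δ : ℝ) (_ : 0 < δ), ⨆ (P : Set (X × ℝ)) (_ : IsPacking F δ P),
    ∑' p : P, ENNReal.ofReal (2 * p.1.2) ^ (d : ℝ)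

/-- The `d`-dimensional packing (outer) measure. -/
def packingMeasure {X : Type*} [MetricSpace X] (d : ℝ≥0) (E : Set X) : ℝ≥0∞ :=
  ⨅ (F : ℕ → Set X) (_ : E ⊆ ⋃ i, F i), ∑' i, packingPremeasure d (F i)

/-- Packing dimension, `sup {d ≥ 0 : P^d(E) = ∞}` (compare Mathlib's `dimH`). -/
def packingDim {X : Type*} [MetricSpace X] (E : Set X) : ℝ≥0∞ :=
  ⨆ (d : ℝ≥0) (_ : packingMeasure d E = ∞), (d : ℝ≥0∞)

/-- The product `A₁ × A₂` as a subset of the Euclidean plane. -/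
def planeProd (A₁ A₂ : Set ℝ) : Set Plane := {p | p 0 ∈ A₁ ∧ p 1 ∈ A₂}

/-- `p` is the centre of a nondegenerate square with axes-parallel sides and all four vertices
in `B`. -/
def IsCenterOfSquareIn (B : Set Plane) (p : Plane) : Prop :=
  ∃ r : ℝ, 0 < r ∧ !₂[p 0 - r, p 1 - r] ∈ B ∧ !₂[p 0 + r, p 1 - r] ∈ B ∧
    !₂[p 0 - r, p 1 + r] ∈ B ∧ !₂[p 0 + r, p 1 + r] ∈ B

/-- There is `r > 0` with `x - r, x + r, y - r, y + r ∈ A`, where `p = (x, y)`. -/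
def HasCommonRadius (A : Set ℝ) (p : Plane) : Prop :=
  ∃ r : ℝ, 0 < r ∧ p 0 - r ∈ A ∧ p 0 + r ∈ A ∧ p 1 - r ∈ A ∧ p 1 + r ∈ A

/-- The set `D_k` of all `a + b k + c k² + d k³` with integers `a, b, c, d` between `-k + 1` and
`2 k - 2` such that `a b c d = 0`. -/
def digitSet (k : ℕ) : Set ℝ :=
  {x | ∃ a b c d : ℤ, a ∈ Icc (-(k : ℤ) + 1) (2 * k - 2) ∧ b ∈ Icc (-(k : ℤ) + 1) (2 * k - 2) ∧
    c ∈ Icc (-(k : ℤ) + 1) (2 * k - 2) ∧ d ∈ Icc (-(k : ℤ) + 1) (2 * k - 2) ∧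
    a * b * c * d = 0 ∧ x = a + b * k + c * k ^ 2 + d * k ^ 3}

/-- The infinite sumset `Q 0 + Q 1 + Q 2 + ⋯`. -/
def infiniteSumset (Q : ℕ → Set ℝ) : Set ℝ :=
  {x | ∃ q : ℕ → ℝ, (∀ i, q i ∈ Q i) ∧ HasSum q x}

/-- `A = t₁ D₁ + t₂ D₂ + ⋯` for some scales `t_k > 0` with `∑ t_k k⁴ < ∞` (so that, because
`D_k ⊆ [-k⁴, 2 k⁴]`, every choice of summands gives a convergent series). -/
def IsDigitSumset (A : Set ℝ) : Prop :=
  ∃ t : ℕ → ℝ, (∀ k, 0 < t k) ∧ Summable (fun k : ℕ => t k * ((k : ℝ) + 1) ^ 4) ∧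
    A = infiniteSumset (fun k => (fun x => t k * x) '' digitSet (k + 1))

end

/-! Everything rests on one digit identity. Let `x` and `y` have base `k` digits `(a, b, c, d)` and
`(a₁, b₁, c₁, d₁)`, units first, and put `r = a - b k + c₁ k² - d₁ k³`. Computing coefficientwise,
without carries, `x - r` loses its units coefficient, `x + r` its coefficient of `k`, `y - r` that
of `k²` and `y + r` that of `k³`. So all four lie in `digitSet k`, which has only `O(k³)` elements,
although `x` and `y` range over all `k⁴` four-digit numbers (`exists_isDigitRadius`). Used at every
level of an infinite sum, this finds the vertices in a set with much sparser digits than the set of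
centers (`hasCommonRadius_of_mem_centerSet`). A second choice of `r` at one level ensures that the
total radius is not zero.

The scales are powers of factorials. A sumset with about `(i + 1) ^ m` digits at level `i` has about
`(k!) ^ m` pieces of size about `(k!) ^ (-4 / σ)`, hence dimension `m σ / 4`; factors `C ^ k` are
negligible beside factorials. Centers have `m = 4`, vertices `m = 3`, and squaring a set doubles its
dimension. Counting partial sums bounds box and packing dimension from above
(`coverBound_infiniteSumset`). Mapping a separated subset onto `[0, 1)` by a Hölder function bounds
Hausdorff dimension, the smallest of the dimensions, from below (`exists_holderOnWith_onto`).
`infiniteSumset_dimensions` combines the two bounds. For `σ = 1` the scales are the reciprocal place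
values of the mixed radix system with bases `(i + 1) ^ 4`, so that the center set contains `[0, 1]`.
-/

/-! ### Comparison of Hausdorff, box and packing dimension. -/

section Dimensions

variable {X : Type*} [MetricSpace X]

/-- `A` is covered by at most `δ ^ (-s)` balls of radius `δ`, for every `s > t` and all small `δ`. -/
def CoverBound (A : Set X) (t : ℝ) : Prop :=
  ∀ s, t < s → ∀ᶠ δ in 𝓝[>] (0 : ℝ),
    ∃ T : Finset X, (T.card : ℝ) ≤ δ ^ (-s) ∧ ∀ x ∈ A, ∃ c ∈ T, dist x c ≤ δ

/-- The constant costs a factor `K ^ (-s')`, which `δ ^ (s - s')` absorbs for any `s'` strictly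
between `t` and `s`. -/
theorem CoverBound.scaled {A : Set X} {t : ℝ} (h : CoverBound A t) {K : ℝ} (hK : 0 < K)
    {s : ℝ} (hs : t < s) : ∀ᶠ δ in 𝓝[>] (0 : ℝ),
      ∃ T : Finset X, (T.card : ℝ) ≤ δ ^ (-s) ∧ ∀ x ∈ A, ∃ c ∈ T, dist x c ≤ K * δ := by
  obtain ⟨s', hs1, hs2⟩ := exists_between hs
  have h1 : Tendsto (fun δ : ℝ => K * δ) (𝓝[>] 0) (𝓝[>] 0) := by
    refine tendsto_nhdsWithin_iff.2 ⟨?_, ?_⟩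
    · have : Tendsto (fun δ : ℝ => K * δ) (𝓝 0) (𝓝 (K * 0)) := tendsto_id.const_mul K
      rw [mul_zero] at this
      exact this.mono_left nhdsWithin_le_nhds
    · filter_upwards [self_mem_nhdsWithin] with δ hδ
      exact mul_pos hK hδ
  have h2 : Tendsto (fun δ : ℝ => K ^ (-s') * δ ^ (s - s')) (𝓝[>] 0) (𝓝 0) := by
    have h3 : Tendsto (fun δ : ℝ => δ ^ (s - s')) (𝓝 0) (𝓝 (0 ^ (s - s'))) :=
      (Real.continuousAt_rpow_const 0 _ (Or.inr (by linarith)))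
    rw [Real.zero_rpow (by linarith)] at h3
    simpa using (h3.mono_left nhdsWithin_le_nhds).const_mul (K ^ (-s'))
  filter_upwards [h1.eventually (h s' hs1), h2.eventually (ge_mem_nhds one_pos),
    self_mem_nhdsWithin] with δ ⟨T, hT, hT'⟩ hδ1 hδ
  refine ⟨T, hT.trans ?_, hT'⟩
  have hδ : 0 < δ := hδ
  rw [Real.mul_rpow hK.le hδ.le]
  have : δ ^ (-s') = δ ^ (s - s') * δ ^ (-s) := by
    rw [← Real.rpow_add hδ]; congr 1; ring
  rw [this, ← mul_assoc]
  exact mul_le_of_le_one_left (Real.rpow_nonneg hδ.le _) hδ1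

theorem coverNumber_le_card {A : Set X} {δ : ℝ} (T : Finset X)
    (hT : ∀ x ∈ A, ∃ c ∈ T, dist x c ≤ 1 / 2 * δ) : coverNumber A δ ≤ T.card := by
  refine (iInf₂_le_of_le ((fun c => Metric.closedBall c (1 / 2 * δ)) '' (T : Set X)) ?_
    (iInf_le_of_le ?_ ?_))
  · intro x hx
    obtain ⟨c, hc, hxc⟩ := hT x hx
    exact ⟨_, ⟨c, hc, rfl⟩, hxc⟩
  · rintro _ ⟨c, -, rfl⟩
    refine Metric.ediam_le fun x hx y hy => ?_
    rw [edist_dist]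
    refine ENNReal.ofReal_le_ofReal ?_
    have := dist_triangle_right x y c
    rw [Metric.mem_closedBall] at hx hy
    linarith
  · exact (Set.encard_image_le _ _).trans (by simp)

theorem upperBoxDim_le {A : Set X} {t : ℝ} (h : CoverBound A t) : upperBoxDim A ≤ t := by
  rw [← EReal.le_of_forall_lt_iff_le]
  intro s hs
  have hs : t < s := by exact_mod_cast hs
  refine limsup_le_of_le (by isBoundedDefault) ?_
  filter_upwards [h.scaled (K := 1 / 2) (by norm_num) hs, self_mem_nhdsWithin,
    mem_nhdsWithin_of_mem_nhds (Iio_mem_nhds one_pos)] with δ ⟨T, hT, hT'⟩ hδ hδ1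
  have hδ : 0 < δ := hδ
  have hlog : 0 < -Real.log δ := by have := Real.log_neg hδ hδ1; linarith
  rw [boxQuotient, EReal.div_le_iff_le_mul (by exact_mod_cast hlog) (EReal.coe_ne_top _)]
  have h1 : ((coverNumber A δ : ℕ∞) : ℝ≥0∞) ≤ ENNReal.ofReal (δ ^ (-s)) := by
    have : ((coverNumber A δ : ℕ∞) : ℝ≥0∞) ≤ ((T.card : ℕ∞) : ℝ≥0∞) :=
      ENat.toENNReal_le.2 (coverNumber_le_card T hT')
    refine this.trans ?_
    rw [ENat.toENNReal_coe, ← ENNReal.ofReal_natCast]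
    exact ENNReal.ofReal_le_ofReal hT
  refine (ENNReal.log_le_log_iff.2 h1).trans ?_
  rw [ENNReal.log_ofReal_of_pos (Real.rpow_pos_of_pos hδ _), Real.log_rpow hδ]
  refine le_of_eq ?_
  norm_cast
  ring

theorem one_le_coverNumber {A : Set X} (hA : A.Nonempty) (δ : ℝ) : 1 ≤ coverNumber A δ := by
  refine le_iInf₂ fun cov hcov => le_iInf fun _ => ?_
  obtain ⟨x, hx⟩ := hA
  obtain ⟨U, hU, -⟩ := hcov hx
  exact Set.one_le_encard_iff_nonempty.2 ⟨U, hU⟩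

-- Otherwise there are arbitrarily small `δ` with fewer than `δ ^ (-s)` covering sets of diameter at
-- most `δ`. Their `s`-th powers sum to at most `1`, which keeps the Hausdorff measure finite.
open MeasureTheory in
theorem eventually_rpow_le_coverNumber [MeasurableSpace X] [BorelSpace X] {A : Set X} {s : ℝ≥0}
    (h : μH[s] A = ∞) :
    ∀ᶠ δ in 𝓝[>] (0 : ℝ), ENNReal.ofReal (δ ^ (-(s : ℝ))) ≤ ((coverNumber A δ : ℕ∞) : ℝ≥0∞) := by
  by_contra hcon
  have hfr : ∃ᶠ δ in 𝓝[>] (0 : ℝ), 0 < δ ∧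
      ((coverNumber A δ : ℕ∞) : ℝ≥0∞) < ENNReal.ofReal (δ ^ (-(s : ℝ))) := by
    refine ((not_eventually.1 hcon).and_eventually self_mem_nhdsWithin).mono ?_
    rintro δ ⟨h1, h2⟩
    exact ⟨h2, not_le.1 h1⟩
  have hex : ∀ δ : ℝ, ∃ cov : Finset (Set X), (0 < δ ∧
      ((coverNumber A δ : ℕ∞) : ℝ≥0∞) < ENNReal.ofReal (δ ^ (-(s : ℝ)))) →
      A ⊆ ⋃₀ (cov : Set (Set X)) ∧ (∀ U ∈ cov, Metric.ediam U ≤ ENNReal.ofReal δ) ∧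
      (cov.card : ℝ≥0∞) < ENNReal.ofReal (δ ^ (-(s : ℝ))) := by
    intro δ
    by_cases hδ : 0 < δ ∧ ((coverNumber A δ : ℕ∞) : ℝ≥0∞) < ENNReal.ofReal (δ ^ (-(s : ℝ)))
    · have hne : coverNumber A δ < ⊤ := by
        rw [lt_top_iff_ne_top]
        intro hh
        simp [hh] at hδ
      obtain ⟨n, hn⟩ := ENat.ne_top_iff_exists.1 hne.ne
      -- The strict bound by `n + 1` extracts from the infimum a cover with at most `n` sets.
      have hlt : coverNumber A δ < n + 1 := by
        rw [← hn]; exact_mod_cast Nat.lt_succ_self n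
      simp only [coverNumber, iInf_lt_iff] at hlt
      obtain ⟨cov, h1, h2, h3⟩ := hlt
      have hfin : cov.Finite := by
        rw [← Set.encard_lt_top_iff]
        exact h3.trans_le le_top
      refine ⟨hfin.toFinset, fun _ => ⟨by simpa using h1, by simpa using h2, ?_⟩⟩
      refine lt_of_le_of_lt ?_ hδ.2
      rw [← hn]
      rw [hfin.encard_eq_coe_toFinset_card] at h3
      have : hfin.toFinset.card ≤ n := by
        have : hfin.toFinset.card < n + 1 := by exact_mod_cast h3
        omega
      simpa using this
    · exact ⟨∅, fun hh => absurd hh hδ⟩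
  choose cov hcov using hex
  -- Restricting the filter to the bad `δ` gives efficient covers along the whole filter.
  set l := 𝓝[>] (0 : ℝ) ⊓ 𝓟 {δ | 0 < δ ∧
      ((coverNumber A δ : ℕ∞) : ℝ≥0∞) < ENNReal.ofReal (δ ^ (-(s : ℝ)))} with hl
  have hlne : l.NeBot := frequently_mem_iff_neBot.1 hfr
  have hbad : ∀ᶠ δ in l, 0 < δ ∧
      ((coverNumber A δ : ℕ∞) : ℝ≥0∞) < ENNReal.ofReal (δ ^ (-(s : ℝ))) :=
    mem_inf_of_right (mem_principal_self _)
  have hr : Tendsto (fun δ : ℝ => ENNReal.ofReal δ) l (𝓝 0) := by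
    have : Tendsto (fun δ : ℝ => ENNReal.ofReal δ) (𝓝 0) (𝓝 (ENNReal.ofReal 0)) :=
      (ENNReal.continuous_ofReal.tendsto 0)
    rw [ENNReal.ofReal_zero] at this
    exact this.mono_left (inf_le_left.trans nhdsWithin_le_nhds)
  have key := Measure.hausdorffMeasure_le_liminf_sum (ι := fun δ => cov δ) (s : ℝ) A
    (fun δ : ℝ => ENNReal.ofReal δ) hr (fun δ U => (U : Set X))
    (hbad.mono fun δ hδ U => (hcov δ hδ).2.1 U U.2)
    (hbad.mono fun δ hδ => by
      have := (hcov δ hδ).1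
      rwa [Set.sUnion_eq_iUnion] at this)
  have hle : liminf (fun δ => ∑ U : cov δ, Metric.ediam (U : Set X) ^ (s : ℝ)) l ≤ 1 := by
    refine liminf_le_of_frequently_le' (Eventually.frequently ?_)
    refine hbad.mono fun δ hδ => ?_
    obtain ⟨-, h2, h3⟩ := hcov δ hδ
    calc ∑ U : cov δ, Metric.ediam (U : Set X) ^ (s : ℝ)
        ≤ ∑ _U : cov δ, ENNReal.ofReal δ ^ (s : ℝ) := by
          gcongr with U
          exact h2 U U.2
      _ = (cov δ).card * ENNReal.ofReal δ ^ (s : ℝ) := by simp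
      _ ≤ ENNReal.ofReal (δ ^ (-(s : ℝ))) * ENNReal.ofReal δ ^ (s : ℝ) := by gcongr
      _ = 1 := by
          rw [ENNReal.ofReal_rpow_of_pos hδ.1, ← ENNReal.ofReal_mul (Real.rpow_nonneg hδ.1.le _),
            ← Real.rpow_add hδ.1]
          simp
  rw [h] at key
  exact absurd (key.trans hle) (by simp)

theorem le_lowerBoxDim {A : Set X} {t : ℝ} (hA : A.Nonempty)
    (h : ENNReal.ofReal t ≤ dimH A) : (t : EReal) ≤ lowerBoxDim A := by
  borelize X
  rw [← EReal.ge_of_forall_gt_iff_ge]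
  intro s hs
  have hs : s < t := by exact_mod_cast hs
  refine le_liminf_of_le (by isBoundedDefault) ?_
  have hev : ∀ᶠ δ in 𝓝[>] (0 : ℝ), δ < 1 ∧ 0 < δ := by
    filter_upwards [self_mem_nhdsWithin, mem_nhdsWithin_of_mem_nhds (Iio_mem_nhds one_pos)]
      with δ h1 h2
    exact ⟨h2, h1⟩
  have hN : ∀ᶠ δ in 𝓝[>] (0 : ℝ), ENNReal.ofReal (δ ^ (-s)) ≤ ((coverNumber A δ : ℕ∞) : ℝ≥0∞) := by
    rcases le_or_gt s 0 with hs0 | hs0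
    · filter_upwards [hev] with δ ⟨h1, h2⟩
      have hN1 : ((1 : ℕ∞) : ℝ≥0∞) ≤ ((coverNumber A δ : ℕ∞) : ℝ≥0∞) :=
        ENat.toENNReal_le.2 (one_le_coverNumber hA δ)
      refine le_trans ?_ hN1
      simpa using Real.rpow_le_one h2.le h1.le (neg_nonneg.2 hs0)
    · lift s to ℝ≥0 using hs0.le
      refine eventually_rpow_le_coverNumber (hausdorffMeasure_of_lt_dimH (lt_of_lt_of_le ?_ h))
      rw [← ENNReal.ofReal_coe_nnreal]
      exact (ENNReal.ofReal_lt_ofReal_iff (hs0.trans hs)).2 hs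
  filter_upwards [hev, hN] with δ ⟨h1, h2⟩ h3
  have hlog : 0 < -Real.log δ := by have := Real.log_neg h2 h1; linarith
  rw [boxQuotient, EReal.le_div_iff_mul_le (by exact_mod_cast hlog) (EReal.coe_ne_top _)]
  refine le_trans ?_ (ENNReal.log_le_log_iff.2 h3)
  rw [ENNReal.log_ofReal_of_pos (Real.rpow_pos_of_pos h2 _), Real.log_rpow h2]
  refine le_of_eq ?_
  norm_cast
  ring

-- By Vitali's lemma, a disjoint family of balls of radius `δ` centred in `F` covers `F` once
-- enlarged five times. The family is a packing, and the enlarged balls have diameter at most `5 *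
-- (2 * δ)`.
open MeasureTheory in
theorem hausdorffMeasure_le_packingPremeasure [TopologicalSpace.SeparableSpace X]
    [MeasurableSpace X] [BorelSpace X] (F : Set X) (d : ℝ≥0) :
    μH[d] F ≤ 5 ^ (d : ℝ) * packingPremeasure d F := by
  have h5 : (5 : ℝ≥0∞) ^ (d : ℝ) ≠ 0 := by simp
  have h5' : (5 : ℝ≥0∞) ^ (d : ℝ) ≠ ∞ := by simp
  rw [mul_comm, ← ENNReal.div_le_iff h5 h5']
  refine le_iInf₂ fun δ₀ hδ₀ => ?_
  rw [ENNReal.div_le_iff h5 h5', mul_comm]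
  have hex : ∀ δ : ℝ, ∃ u ⊆ F, (u.PairwiseDisjoint fun a => Metric.closedBall a δ) ∧
      ∀ a ∈ F, ∃ b ∈ u, Metric.closedBall a δ ⊆ Metric.closedBall b (5 * δ) := fun δ =>
    Vitali.exists_disjoint_subfamily_covering_enlargement_closedBall F (fun x => x)
      (fun _ => δ) δ (fun _ _ => le_rfl) 5 (by norm_num)
  choose u huF hud huc using hex
  have hcount : ∀ δ : ℝ, 0 < δ → (u δ).Countable := fun δ hδ =>
    (hud δ).countable_of_nonempty_interior fun x _ =>
      ⟨x, Metric.ball_subset_interior_closedBall (Metric.mem_ball_self hδ)⟩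
  -- The index sets must be countable for every real `δ`, hence the default value.
  let v : ℝ → Set X := fun δ => if 0 < δ then u δ else ∅
  have hv : ∀ δ, 0 < δ → v δ = u δ := fun δ hδ => if_pos hδ
  have hvc : ∀ δ, Countable (v δ) := by
    intro δ
    by_cases hδ : 0 < δ
    · rw [hv δ hδ]; exact (hcount δ hδ).to_subtype
    · simp only [v, if_neg hδ]; infer_instance
  have hr : Tendsto (fun δ : ℝ => ENNReal.ofReal (10 * δ)) (𝓝[>] 0) (𝓝 0) := by
    have h1 : Continuous fun δ : ℝ => ENNReal.ofReal (10 * δ) :=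
      ENNReal.continuous_ofReal.comp (continuous_const.mul continuous_id)
    have := h1.tendsto 0
    simp only [mul_zero, ENNReal.ofReal_zero] at this
    exact this.mono_left nhdsWithin_le_nhds
  have hdiam : ∀ (c : X) (δ : ℝ), Metric.ediam (Metric.closedBall c (5 * δ))
      ≤ ENNReal.ofReal (10 * δ) := by
    intro c δ
    refine Metric.ediam_le fun x hx y hy => ?_
    rw [edist_dist]
    refine ENNReal.ofReal_le_ofReal ?_
    have := dist_triangle_right x y c
    rw [Metric.mem_closedBall] at hx hy
    linarith
  refine (Measure.hausdorffMeasure_le_liminf_tsum (ι := fun δ => v δ) (d : ℝ) F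
    (fun δ : ℝ => ENNReal.ofReal (10 * δ)) hr (fun δ c => Metric.closedBall (c : X) (5 * δ))
    (Eventually.of_forall fun δ c => hdiam c δ) ?_).trans ?_
  · filter_upwards [self_mem_nhdsWithin] with δ hδ x hx
    obtain ⟨b, hb, hxb⟩ := huc δ x hx
    rw [← hv δ hδ] at hb
    exact mem_iUnion.2 ⟨⟨b, hb⟩, hxb (Metric.mem_closedBall_self (le_of_lt hδ))⟩
  · refine liminf_le_of_frequently_le' (Eventually.frequently ?_)
    filter_upwards [self_mem_nhdsWithin, mem_nhdsWithin_of_mem_nhds (Iio_mem_nhds hδ₀)]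
      with δ hδ hδ1
    have hδ : 0 < δ := hδ
    have hδ1 : δ < δ₀ := hδ1
    have hpack : IsPacking F δ₀ ((fun c => (c, δ)) '' v δ) := by
      rw [hv δ hδ]
      refine ⟨(hcount δ hδ).image _, ?_, ?_⟩
      · rintro _ ⟨c, hc, rfl⟩
        exact ⟨huF δ hc, hδ, hδ1.le⟩
      · rintro _ ⟨c, hc, rfl⟩ _ ⟨c', hc', rfl⟩ hne
        exact hud δ hc hc' fun h => hne (by rw [h])
    calc ∑' c : v δ, Metric.ediam (Metric.closedBall (c : X) (5 * δ)) ^ (d : ℝ)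
        ≤ ∑' c : v δ, 5 ^ (d : ℝ) * ENNReal.ofReal (2 * δ) ^ (d : ℝ) := by
          refine ENNReal.tsum_le_tsum fun c => ?_
          rw [← ENNReal.mul_rpow_of_nonneg _ _ d.coe_nonneg]
          refine ENNReal.rpow_le_rpow ((hdiam c δ).trans (le_of_eq ?_)) d.coe_nonneg
          rw [show (5 : ℝ≥0∞) = ENNReal.ofReal 5 by simp,
            ← ENNReal.ofReal_mul (by norm_num)]
          congr 1; ring
      _ = 5 ^ (d : ℝ) * ∑' c : v δ, ENNReal.ofReal (2 * δ) ^ (d : ℝ) := ENNReal.tsum_mul_left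
      _ = 5 ^ (d : ℝ) * ∑' p : ((fun c => (c, δ)) '' v δ : Set (X × ℝ)),
            ENNReal.ofReal (2 * p.1.2) ^ (d : ℝ) := by
          rw [tsum_image (fun p : X × ℝ => ENNReal.ofReal (2 * p.2) ^ (d : ℝ))]
          intro a _ b _ hab
          exact (Prod.mk.inj hab).1
      _ ≤ _ := by
          gcongr
          exact le_iSup₂ (f := fun (P : Set (X × ℝ)) (_ : IsPacking F δ₀ P) =>
            ∑' p : P, ENNReal.ofReal (2 * p.1.2) ^ (d : ℝ)) _ hpack

open MeasureTheory in
theorem dimH_le_packingDim [TopologicalSpace.SeparableSpace X] (E : Set X) :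
    dimH E ≤ packingDim E := by
  borelize X
  refine dimH_le fun d hd => ?_
  have h5' : (5 : ℝ≥0∞) ^ (d : ℝ) ≠ ∞ := by simp
  refine le_iSup₂_of_le d ?_ le_rfl
  by_contra hcon
  have hlt : packingMeasure d E < ∞ := lt_top_iff_ne_top.2 hcon
  simp only [packingMeasure, iInf_lt_iff] at hlt
  obtain ⟨F, hF, hlt⟩ := hlt
  have : μH[d] E ≤ 5 ^ (d : ℝ) * ∑' i, packingPremeasure d (F i) := by
    rw [← ENNReal.tsum_mul_left]
    refine (measure_mono hF).trans ((measure_iUnion_le _).trans ?_)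
    exact ENNReal.tsum_le_tsum fun i => hausdorffMeasure_le_packingPremeasure (F i) d
  rw [hd] at this
  exact (ENNReal.mul_lt_top (lt_top_iff_ne_top.2 h5') hlt).ne (top_le_iff.1 this)

theorem packingPremeasure_empty (d : ℝ≥0) : packingPremeasure d (∅ : Set X) = 0 := by
  refine le_antisymm (iInf₂_le_of_le 1 one_pos (iSup₂_le fun P hP => ?_)) bot_le
  have : P = ∅ := by
    ext p
    simp only [mem_empty_iff_false, iff_false]
    exact fun hp => (hP.2.1 p hp).1
  subst this
  simp

theorem packingMeasure_le_packingPremeasure (d : ℝ≥0) (E : Set X) :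
    packingMeasure d E ≤ packingPremeasure d E := by
  refine iInf₂_le_of_le (fun i => if i = 0 then E else ∅)
    (fun x hx => mem_iUnion.2 ⟨0, by simpa using hx⟩) ?_
  rw [tsum_eq_single 0]
  · simp
  · intro i hi
    simp [hi, packingPremeasure_empty]

/-- Two centers assigned to the same point of `T` are at distance at most `ρ`, less than either
radius, so their balls would meet. Hence there are at most `T.card` balls. -/
theorem packing_annulus_le {E : Set X} {δ ρ : ℝ} {P : Set (X × ℝ)} (hP : IsPacking E δ P)
    (hρ : 0 < ρ) (d : ℝ≥0) (T : Finset X) (hT : ∀ x ∈ E, ∃ c ∈ T, dist x c ≤ 1 / 2 * ρ) :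
    ∑' p : {p ∈ P | ρ < p.2 ∧ p.2 ≤ 2 * ρ}, ENNReal.ofReal (2 * (p : X × ℝ).2) ^ (d : ℝ)
      ≤ ENNReal.ofReal (T.card * (4 * ρ) ^ (d : ℝ)) := by
  have hcard : {p ∈ P | ρ < p.2 ∧ p.2 ≤ 2 * ρ}.encard ≤ T.card := by
    choose! c hcT hc using hT
    have := Set.encard_le_encard_of_injOn (s := {p ∈ P | ρ < p.2 ∧ p.2 ≤ 2 * ρ})
      (t := (T : Set X)) (f := fun p => c p.1) (fun p hp => hcT _ (hP.2.1 p hp.1).1) ?_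
    · simpa using this
    · intro p hp q hq hpq
      by_contra hne
      have hdis := hP.2.2 hp.1 hq.1 hne
      have h1 := hc _ (hP.2.1 p hp.1).1
      have h2 := hc _ (hP.2.1 q hq.1).1
      simp only at hpq
      rw [← hpq] at h2
      have h3 := dist_triangle_right q.1 p.1 (c p.1)
      have h4 : q.1 ∈ Metric.closedBall p.1 p.2 := by
        rw [Metric.mem_closedBall]
        linarith [hp.2.1]
      exact Set.disjoint_left.1 hdis h4 (Metric.mem_closedBall_self (hP.2.1 q hq.1).2.1.le)
  calc ∑' p : {p ∈ P | ρ < p.2 ∧ p.2 ≤ 2 * ρ}, ENNReal.ofReal (2 * (p : X × ℝ).2) ^ (d : ℝ)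
      ≤ ∑' p : {p ∈ P | ρ < p.2 ∧ p.2 ≤ 2 * ρ}, ENNReal.ofReal (4 * ρ) ^ (d : ℝ) := by
        refine ENNReal.tsum_le_tsum fun p => ?_
        refine ENNReal.rpow_le_rpow (ENNReal.ofReal_le_ofReal ?_) d.2
        linarith [p.2.2.2]
    _ = {p ∈ P | ρ < p.2 ∧ p.2 ≤ 2 * ρ}.encard * ENNReal.ofReal (4 * ρ) ^ (d : ℝ) :=
        ENNReal.tsum_set_const _ _
    _ ≤ T.card * ENNReal.ofReal (4 * ρ) ^ (d : ℝ) := by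
        gcongr
        simpa using ENat.toENNReal_le.2 hcard
    _ = ENNReal.ofReal (T.card * (4 * ρ) ^ (d : ℝ)) := by
        rw [ENNReal.ofReal_rpow_of_pos (by positivity), ENNReal.ofReal_mul (Nat.cast_nonneg _),
          ENNReal.ofReal_natCast]

/-- For `t < s < d`, sort the balls of a packing by dyadic size. Those of radius about `ρ`
contribute at most a constant times `ρ ^ (d - s)`, and these bounds form a convergent geometric
series. -/
theorem packingDim_le {E : Set X} {t : ℝ} (h : CoverBound E t) :
    packingDim E ≤ ENNReal.ofReal t := by
  refine iSup₂_le fun d hd => ?_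
  by_contra hcon
  rw [not_le, ← ENNReal.ofReal_coe_nnreal, ENNReal.ofReal_lt_ofReal_iff'] at hcon
  obtain ⟨s, hts, hsd⟩ := exists_between hcon.1
  obtain ⟨δ₀, hδ₀, hcov⟩ := mem_nhdsGT_iff_exists_Ioc_subset.1
    (h.scaled (K := 1 / 2) (by norm_num) hts)
  have hδ₀ : 0 < δ₀ := hδ₀
  have hpre : packingPremeasure d E < ∞ := by
    set q : ℝ := 2⁻¹ ^ ((d : ℝ) - s) with hq
    have hq0 : 0 ≤ q := by positivity
    have hq1 : q < 1 := Real.rpow_lt_one (by norm_num) (by norm_num) (by linarith)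
    have hsum : Summable fun k : ℕ => (4 : ℝ) ^ (d : ℝ) * δ₀ ^ ((d : ℝ) - s) * q ^ (k + 1) :=
      ((summable_nat_add_iff 1).2 (summable_geometric_of_lt_one hq0 hq1)).mul_left _
    refine lt_of_le_of_lt (iInf₂_le_of_le δ₀ hδ₀ (iSup₂_le fun P hP => ?_))
      (ENNReal.ofReal_lt_top (r := ∑' k : ℕ, (4 : ℝ) ^ (d : ℝ) * δ₀ ^ ((d : ℝ) - s) * q ^ (k + 1)))
    set ρ : ℕ → ℝ := fun k => δ₀ * 2⁻¹ ^ (k + 1) with hρ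
    have hρpos : ∀ k, 0 < ρ k := fun k => by positivity
    have hU : P ⊆ ⋃ k, {p ∈ P | ρ k < p.2 ∧ p.2 ≤ 2 * ρ k} := by
      intro p hp
      obtain ⟨-, hp0, hpδ⟩ := hP.2.1 p hp
      obtain ⟨k, hk1, hk2⟩ := exists_nat_pow_near_of_lt_one (x := p.2 / δ₀) (y := (2⁻¹ : ℝ))
        (by positivity) ((div_le_one hδ₀).2 hpδ) (by norm_num) (by norm_num)
      refine mem_iUnion.2 ⟨k, hp, ?_, ?_⟩
      · rw [lt_div_iff₀ hδ₀] at hk1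
        simp only [hρ]; linarith
      · rw [div_le_iff₀ hδ₀] at hk2
        simp only [hρ, pow_succ]; linarith
    have hP' : P = ⋃ k, {p ∈ P | ρ k < p.2 ∧ p.2 ≤ 2 * ρ k} :=
      Set.Subset.antisymm hU (iUnion_subset fun k p hp => hp.1)
    calc ∑' p : P, ENNReal.ofReal (2 * p.1.2) ^ (d : ℝ)
        = ∑' p : (⋃ k, {p ∈ P | ρ k < p.2 ∧ p.2 ≤ 2 * ρ k} : Set (X × ℝ)),
            ENNReal.ofReal (2 * p.1.2) ^ (d : ℝ) := by rw [← hP']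
      _ ≤ ∑' k, ∑' p : {p ∈ P | ρ k < p.2 ∧ p.2 ≤ 2 * ρ k},
            ENNReal.ofReal (2 * (p : X × ℝ).2) ^ (d : ℝ) :=
          ENNReal.tsum_iUnion_le_tsum (fun p : X × ℝ => ENNReal.ofReal (2 * p.2) ^ (d : ℝ)) _
      _ ≤ ∑' k : ℕ, ENNReal.ofReal ((4 : ℝ) ^ (d : ℝ) * δ₀ ^ ((d : ℝ) - s) * q ^ (k + 1)) := by
          refine ENNReal.tsum_le_tsum fun k => ?_
          have hk : ρ k ∈ Ioc 0 δ₀ := ⟨hρpos k, by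
            simp only [hρ]
            exact mul_le_of_le_one_right hδ₀.le (pow_le_one₀ (by norm_num) (by norm_num))⟩
          obtain ⟨T, hT, hT'⟩ := hcov hk
          refine (packing_annulus_le hP (hρpos k) d T hT').trans (ENNReal.ofReal_le_ofReal ?_)
          have h4 : 0 ≤ (4 * ρ k) ^ (d : ℝ) := Real.rpow_nonneg (by have := hρpos k; linarith) _
          refine (mul_le_mul_of_nonneg_right hT h4).trans (le_of_eq ?_)
          rw [Real.mul_rpow (by norm_num) (hρpos k).le, mul_left_comm, ← Real.rpow_add (hρpos k),
            mul_assoc]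
          congr 1
          rw [hρ, Real.mul_rpow hδ₀.le (by positivity), hq, ← Real.rpow_natCast, ← Real.rpow_natCast,
            ← Real.rpow_mul (by norm_num), ← Real.rpow_mul (by norm_num)]
          congr 2 <;> ring
      _ = _ := (ENNReal.ofReal_tsum_of_nonneg (fun k => by positivity) hsum).symm
  rw [← not_le, top_le_iff] at hpre
  exact hpre (top_le_iff.1 (hd ▸ packingMeasure_le_packingPremeasure d E))

theorem dimensions_eq [TopologicalSpace.SeparableSpace X] {E : Set X} {t : ℝ}
    (hE : E.Nonempty) (hU : CoverBound E t) (hL : ENNReal.ofReal t ≤ dimH E) :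
    dimH E = ENNReal.ofReal t ∧ HasBoxDim E t ∧ packingDim E = ENNReal.ofReal t := by
  have h1 := dimH_le_packingDim E
  have h2 := packingDim_le hU
  have h3 := le_lowerBoxDim hE hL
  have h4 := upperBoxDim_le hU
  have h5 : lowerBoxDim E ≤ upperBoxDim E := liminf_le_limsup (by isBoundedDefault)
    (by isBoundedDefault)
  exact ⟨le_antisymm (h1.trans h2) hL, ⟨le_antisymm (h5.trans h4) h3,
    le_antisymm h4 (h3.trans h5)⟩, le_antisymm h2 (hL.trans h1)⟩

end Dimensions

/-! ### Products in the plane and lower bounds from Hölder maps. -/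

theorem Plane.dist_le_add (p q : Plane) : dist p q ≤ |p 0 - q 0| + |p 1 - q 1| := by
  rw [EuclideanSpace.dist_eq, Fin.sum_univ_two, Real.dist_eq, Real.dist_eq]
  refine Real.sqrt_le_iff.2 ⟨by positivity, ?_⟩
  nlinarith [abs_nonneg (p 0 - q 0), abs_nonneg (p 1 - q 1)]

theorem Plane.abs_sub_le_dist (p q : Plane) (i : Fin 2) : |p i - q i| ≤ dist p q := by
  rw [← Real.dist_eq]
  exact (PiLp.dist_apply_le p q i)

open scoped Classical in
theorem CoverBound.planeProd {A : Set ℝ} {t : ℝ} (h : CoverBound A t) :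
    CoverBound (planeProd A A) (2 * t) := by
  intro s hs
  filter_upwards [h.scaled (K := 1 / 2) (by norm_num) (show t < s / 2 by linarith),
    self_mem_nhdsWithin] with δ ⟨T, hT, hT'⟩ hδ
  have hδ : 0 < δ := hδ
  refine ⟨(T ×ˢ T).image fun c => !₂[c.1, c.2], ?_, ?_⟩
  · have h1 : (((T ×ˢ T).image fun c => (!₂[c.1, c.2] : Plane)).card : ℝ) ≤ T.card * T.card := by
      have := Finset.card_image_le (s := T ×ˢ T) (f := fun c => (!₂[c.1, c.2] : Plane))
      rw [Finset.card_product] at this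
      exact_mod_cast this
    refine h1.trans ((mul_le_mul hT hT (by positivity) (by positivity)).trans (le_of_eq ?_))
    rw [← Real.rpow_add hδ]
    congr 1; ring
  · rintro p ⟨h0, h1⟩
    obtain ⟨c, hc, hc'⟩ := hT' _ h0
    obtain ⟨c', hc1, hc1'⟩ := hT' _ h1
    refine ⟨!₂[c, c'], Finset.mem_image.2 ⟨(c, c'), Finset.mk_mem_product hc hc1, rfl⟩, ?_⟩
    refine (Plane.dist_le_add _ _).trans ?_
    rw [Real.dist_eq] at hc' hc1'
    simp only [Matrix.cons_val_zero, Matrix.cons_val_one]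
    linarith

/-- A Hölder map of exponent `τ` multiplies dimension by at most `1 / τ`, and its image here has
dimension one. -/
theorem le_dimH_of_holderOnWith {P : Set ℝ} {f : ℝ → ℝ} {K τ : ℝ≥0} (hτ : 0 < τ)
    (hf : HolderOnWith K τ f P) (hsurj : Ico 0 1 ⊆ f '' P) : (τ : ℝ≥0∞) ≤ dimH P := by
  have h1 : dimH (f '' P) = 1 := by
    have := Real.dimH_of_nonempty_interior (E := ℝ) (s := f '' P)
      ⟨1 / 2, interior_mono hsurj (by rw [interior_Ico]; norm_num)⟩
    simpa using this
  have h2 := hf.dimH_image_le hτ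
  rw [h1, ENNReal.le_div_iff_mul_le (by simp [hτ.ne']) (by simp)] at h2
  simpa using h2

/-- Applying `f` in both coordinates keeps the exponent, and the image contains an open square. This
avoids any product formula for Hausdorff dimension. -/
theorem two_mul_le_dimH_planeProd {P : Set ℝ} {f : ℝ → ℝ} {K τ : ℝ≥0} (hτ : 0 < τ)
    (hf : HolderOnWith K τ f P) (hsurj : Ico 0 1 ⊆ f '' P) :
    2 * (τ : ℝ≥0∞) ≤ dimH (planeProd P P) := by
  let F : Plane → Plane := fun p => !₂[f (p 0), f (p 1)]
  have hF : HolderOnWith (2 * K) τ F (planeProd P P) := by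
    intro p hp q hq
    have key : ∀ i : Fin 2, p i ∈ P → q i ∈ P → |f (p i) - f (q i)| ≤ K * dist p q ^ (τ : ℝ) := by
      intro i h1 h2
      have := hf.dist_le h1 h2
      rw [Real.dist_eq] at this
      refine this.trans ?_
      gcongr
      exact Plane.abs_sub_le_dist p q i
    have hd : dist (F p) (F q) ≤ (2 * K : ℝ≥0) * dist p q ^ (τ : ℝ) := by
      refine (Plane.dist_le_add _ _).trans ?_
      have a := key 0 hp.1 hq.1
      have b := key 1 hp.2 hq.2
      simp only [F, Matrix.cons_val_zero, Matrix.cons_val_one]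
      push_cast
      linarith
    rw [edist_dist, edist_dist, ENNReal.ofReal_rpow_of_nonneg dist_nonneg τ.coe_nonneg,
      ← ENNReal.ofReal_coe_nnreal, ← ENNReal.ofReal_mul (NNReal.coe_nonneg _)]
    exact ENNReal.ofReal_le_ofReal hd
  have hopen : IsOpen {p : Plane | p 0 ∈ Ioo (0 : ℝ) 1 ∧ p 1 ∈ Ioo (0 : ℝ) 1} := by
    refine IsOpen.inter ?_ ?_
    · exact isOpen_Ioo.preimage (EuclideanSpace.proj (𝕜 := ℝ) (0 : Fin 2)).continuous
    · exact isOpen_Ioo.preimage (EuclideanSpace.proj (𝕜 := ℝ) (1 : Fin 2)).continuous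
  have hsub : {p : Plane | p 0 ∈ Ioo (0 : ℝ) 1 ∧ p 1 ∈ Ioo (0 : ℝ) 1} ⊆ F '' planeProd P P := by
    rintro p ⟨h0, h1⟩
    obtain ⟨x, hx, hx'⟩ := hsurj (Ioo_subset_Ico_self h0)
    obtain ⟨y, hy, hy'⟩ := hsurj (Ioo_subset_Ico_self h1)
    refine ⟨!₂[x, y], ⟨by simpa using hx, by simpa using hy⟩, ?_⟩
    ext i
    fin_cases i <;> simp [F, hx', hy']
  have h1 : dimH (F '' planeProd P P) = 2 := by
    have := Real.dimH_of_nonempty_interior (E := Plane) (s := F '' planeProd P P)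
      ⟨!₂[1 / 2, 1 / 2], interior_mono hsub (by
        rw [hopen.interior_eq]; constructor <;> constructor <;> norm_num)⟩
    simpa using this
  have h2 := hF.dimH_image_le hτ
  rwa [h1, ENNReal.le_div_iff_mul_le (by simp [hτ.ne']) (by simp)] at h2

/-! ### Tail estimates for series dominated by a telescoping sum. -/

section Telescoping

/-- For nonnegative `a`, a bound of this form yields summability and the tail bound `a k` at once;
both the scales and the reciprocal place values provide it. -/
theorem sum_range_abs_le_of_telescope {z a : ℕ → ℝ} (h : ∀ k, |z (k + 1)| ≤ a k - a (k + 1))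
    (k n : ℕ) : ∑ j ∈ Finset.range n, |z (k + 1 + j)| ≤ a k - a (k + n) := by
  induction n with
  | zero => simp
  | succ n ih =>
    rw [Finset.sum_range_succ]
    have := h (k + n)
    rw [show k + 1 + n = k + n + 1 by ring, show k + (n + 1) = k + n + 1 by ring]
    linarith

theorem summable_of_telescope {z a : ℕ → ℝ} (ha : ∀ k, 0 ≤ a k)
    (h : ∀ k, |z (k + 1)| ≤ a k - a (k + 1)) : Summable z := by
  refine (summable_nat_add_iff 1).1 (Summable.of_abs ?_)
  refine summable_of_sum_range_le (c := a 0) (fun _ => abs_nonneg _) fun n => ?_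
  have := sum_range_abs_le_of_telescope h 0 n
  rw [zero_add] at this
  refine (le_of_eq (Finset.sum_congr rfl fun j _ => ?_)).trans (this.trans (by linarith [ha (0 + n)]))
  rw [add_comm]

theorem HasSum.abs_sub_sum_range_le_of_telescope {z a : ℕ → ℝ} {Z : ℝ} (hz : HasSum z Z)
    (ha : ∀ k, 0 ≤ a k) (h : ∀ k, |z (k + 1)| ≤ a k - a (k + 1)) (k : ℕ) :
    |Z - ∑ j ∈ Finset.range (k + 1), z j| ≤ a k := by
  have h1 : Tendsto (fun n => |∑ j ∈ Finset.range (k + 1 + n), z j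
      - ∑ j ∈ Finset.range (k + 1), z j|) atTop (𝓝 |Z - ∑ j ∈ Finset.range (k + 1), z j|) := by
    refine (Tendsto.sub_const ?_ _).abs
    exact hz.tendsto_sum_nat.comp
      (tendsto_atTop_mono (fun n => Nat.le_add_left n (k + 1)) tendsto_id)
  refine le_of_tendsto h1 (Eventually.of_forall fun n => ?_)
  rw [Finset.sum_range_add, add_sub_cancel_left]
  refine (Finset.abs_sum_le_sum_abs _ _).trans ?_
  linarith [sum_range_abs_le_of_telescope h k n, ha (k + n)]

theorem HasSum.abs_sub_le_of_telescope {z a : ℕ → ℝ} {Z : ℝ} (hz : HasSum z Z)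
    (ha : ∀ k, 0 ≤ a k) (h : ∀ k, |z (k + 1)| ≤ a k - a (k + 1)) {k : ℕ}
    (h0 : ∀ j < k, z j = 0) : |Z - z k| ≤ a k := by
  have := hz.abs_sub_sum_range_le_of_telescope ha h k
  rwa [Finset.sum_range_succ, Finset.sum_eq_zero (fun j hj => h0 j (Finset.mem_range.1 hj)),
    _root_.zero_add] at this

end Telescoping

/-! ### Mixed radix expansions. -/

section MixedRadix

/-- The place values `n 0 * n 1 * ⋯ * n (i - 1)` of a mixed radix system. -/
def placeValue (n : ℕ → ℕ) (i : ℕ) : ℕ := ∏ j ∈ Finset.range i, n j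

variable {n : ℕ → ℕ}

theorem placeValue_succ (n : ℕ → ℕ) (i : ℕ) : placeValue n (i + 1) = placeValue n i * n i :=
  Finset.prod_range_succ _ _

theorem placeValue_pos (hn : ∀ i, 1 ≤ n i) (i : ℕ) : 0 < placeValue n i :=
  Finset.prod_pos fun j _ => hn j

theorem tendsto_placeValue (hn : ∀ i, 1 ≤ n i) (hn2 : ∀ i, 2 ≤ n (i + 1)) :
    Tendsto (fun i => (placeValue n i : ℝ)) atTop atTop := by
  have h : ∀ i, 2 ^ i ≤ placeValue n (i + 1) := by
    intro i
    induction i with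
    | zero => exact placeValue_pos hn 1
    | succ i ih => rw [placeValue_succ, pow_succ]; exact Nat.mul_le_mul ih (hn2 i)
  rw [← tendsto_add_atTop_iff_nat 1]
  refine tendsto_atTop_mono (fun i => ?_) (tendsto_pow_atTop_atTop_of_one_lt one_lt_two)
  exact_mod_cast h i

theorem sub_one_div_placeValue (hn : ∀ i, 1 ≤ n i) (k : ℕ) :
    ((n k : ℝ) - 1) / placeValue n (k + 1) = 1 / placeValue n k - 1 / placeValue n (k + 1) := by
  have h1 : (placeValue n k : ℝ) ≠ 0 := by exact_mod_cast (placeValue_pos hn k).ne'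
  have h2 : (n k : ℝ) ≠ 0 := by have := hn k; positivity
  rw [placeValue_succ]
  push_cast
  field_simp

theorem digit_telescope (hn : ∀ i, 1 ≤ n i) {z : ℕ → ℝ} (hz : ∀ i, |z i| ≤ n i - 1) (k : ℕ) :
    |z (k + 1) / placeValue n (k + 1 + 1)|
      ≤ 1 / placeValue n (k + 1) - 1 / placeValue n (k + 1 + 1) := by
  rw [← sub_one_div_placeValue hn, abs_div, Nat.abs_cast]
  exact div_le_div_of_nonneg_right (hz _) (Nat.cast_nonneg _)

/-- With `N k = placeValue n k`, the digits are `⌊N (i + 1) y⌋ mod n i`, and the partial sums are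
the truncations `⌊N k y⌋ / N k`. Only the base `n 0` may be `1`, as it is for the bases `(i + 1) ^
4`. -/
theorem exists_mixedRadix_expansion (hn : ∀ i, 1 ≤ n i) (hn2 : ∀ i, 2 ≤ n (i + 1)) {y : ℝ}
    (hy : y ∈ Ico (0 : ℝ) 1) : ∃ q : ℕ → ℕ, (∀ i, q i < n i) ∧
      HasSum (fun i => (q i : ℝ) / placeValue n (i + 1)) y := by
  refine ⟨fun i => ⌊placeValue n (i + 1) * y⌋₊ % n i, fun i => Nat.mod_lt _ (hn i), ?_⟩
  rw [hasSum_iff_tendsto_nat_of_nonneg (fun i => by positivity)]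
  have hpart : ∀ k, ∑ i ∈ Finset.range k,
      ((⌊placeValue n (i + 1) * y⌋₊ % n i : ℕ) : ℝ) / placeValue n (i + 1)
        = ⌊placeValue n k * y⌋₊ / placeValue n k := by
    intro k
    induction k with
    | zero => simp [placeValue, Nat.floor_eq_zero.2 hy.2]
    | succ k ih =>
      rw [Finset.sum_range_succ, ih]
      have h1 : (placeValue n k : ℝ) ≠ 0 := by exact_mod_cast (placeValue_pos hn k).ne'
      have h2 : (n k : ℝ) ≠ 0 := by have := hn k; positivity
      have h3 : ⌊placeValue n k * y⌋₊ = ⌊placeValue n (k + 1) * y⌋₊ / n k := by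
        rw [← Nat.floor_div_natCast, placeValue_succ]
        congr 1
        push_cast
        field_simp
      have h4 : ((n k * ⌊placeValue n k * y⌋₊ + ⌊placeValue n (k + 1) * y⌋₊ % n k : ℕ) : ℝ)
          = ⌊placeValue n (k + 1) * y⌋₊ := by rw [h3, Nat.div_add_mod]
      rw [← h4, placeValue_succ]
      push_cast
      field_simp
  simp only [hpart]
  have h0 : Tendsto (fun k => 1 / (placeValue n k : ℝ)) atTop (𝓝 0) := by
    simp only [one_div]
    exact tendsto_inv_atTop_zero.comp (tendsto_placeValue hn hn2)
  refine tendsto_of_tendsto_of_tendsto_of_le_of_le (g := fun k => y - 1 / placeValue n k)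
    (h := fun _ => y) (by simpa using h0.const_sub y) tendsto_const_nhds (fun k => ?_) fun k => ?_
  · have h1 : (0 : ℝ) < placeValue n k := by exact_mod_cast placeValue_pos hn k
    have := Nat.lt_floor_add_one ((placeValue n k : ℝ) * y)
    simp only
    rw [sub_le_iff_le_add, ← add_div, le_div_iff₀ h1]
    linarith
  · have h1 : (0 : ℝ) < placeValue n k := by exact_mod_cast placeValue_pos hn k
    have := Nat.floor_le (mul_nonneg h1.le hy.1)
    simp only
    rw [div_le_iff₀ h1]
    linarith

theorem exists_mixedRadix_expansion_Icc (hn : ∀ i, 1 ≤ n i) (hn2 : ∀ i, 2 ≤ n (i + 1)) {y : ℝ}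
    (hy : y ∈ Icc (0 : ℝ) 1) : ∃ q : ℕ → ℕ, (∀ i, q i < n i) ∧
      HasSum (fun i => (q i : ℝ) / placeValue n (i + 1)) y := by
  rcases hy.2.lt_or_eq with h | rfl
  · exact exists_mixedRadix_expansion hn hn2 ⟨hy.1, h⟩
  -- The endpoint `1` has the expansion with all digits maximal, like `0.999…`.
  · refine ⟨fun i => n i - 1, fun i => Nat.sub_lt (hn i) one_pos, ?_⟩
    rw [hasSum_iff_tendsto_nat_of_nonneg (fun i => by positivity)]
    have hpart : ∀ k, ∑ i ∈ Finset.range k, ((n i - 1 : ℕ) : ℝ) / placeValue n (i + 1)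
        = 1 - 1 / placeValue n k := by
      intro k
      induction k with
      | zero => simp [placeValue]
      | succ k ih =>
        rw [Finset.sum_range_succ, ih, Nat.cast_sub (hn k), Nat.cast_one,
          sub_one_div_placeValue hn]
        ring
    simp only [hpart]
    have h0 : Tendsto (fun k => 1 / (placeValue n k : ℝ)) atTop (𝓝 0) := by
      simp only [one_div]
      exact tendsto_inv_atTop_zero.comp (tendsto_placeValue hn hn2)
    simpa using h0.const_sub 1

end MixedRadix

/-! ### Hölder maps that read off digits. -/

section Holder

variable {t : ℕ → ℝ} {n : ℕ → ℕ} {d : ℕ → ℕ → ℝ}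

theorem step_telescope (hstep : ∀ i, t (i + 1) * ((i : ℝ) + 2) ^ 4 ≤ t i) (ht : ∀ i, 0 < t i)
    {z : ℕ → ℝ} (hz : ∀ i, |z i| ≤ ((i : ℝ) + 1) ^ 4 - 1) (k : ℕ) :
    |t (k + 1) * z (k + 1)| ≤ t k - t (k + 1) := by
  have h1 := hz (k + 1)
  have h2 := hstep k
  rw [abs_mul, abs_of_pos (ht _)]
  have h3 := mul_le_mul_of_nonneg_left h1 (ht (k + 1)).le
  push_cast at h3
  rw [show (k : ℝ) + 1 + 1 = k + 2 by ring] at h3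
  linarith

/-- Look at the first index `i` where the digits differ, by `m`. The later terms change `x - x'` by
at most `t i`, which the `+ 1` in the separation hypothesis pays for, so `|x - x'| ≥ t i * m`; on
the other side `|y - y'| ≤ 2 * m / placeValue n (i + 1)`. -/
theorem holder_estimate (ht : ∀ i, 0 < t i)
    (hstep : ∀ i, t (i + 1) * ((i : ℝ) + 2) ^ 4 ≤ t i) (hn : ∀ i, 1 ≤ n i)
    (hd : ∀ i q, q < n i → 0 ≤ d i q ∧ d i q ≤ ((i : ℝ) + 1) ^ 4 - 1)
    (hsep : ∀ i q q', q < n i → q' < n i → q ≠ q' → |(q : ℝ) - q'| + 1 ≤ |d i q - d i q'|)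
    {τ K : ℝ≥0} (hK : ∀ i, 1 / (placeValue n i : ℝ) ≤ K * t i ^ (τ : ℝ))
    {q q' : ℕ → ℕ} (hq : ∀ i, q i < n i) (hq' : ∀ i, q' i < n i) {x x' y y' : ℝ}
    (hx : HasSum (fun i => t i * d i (q i)) x) (hx' : HasSum (fun i => t i * d i (q' i)) x')
    (hy : HasSum (fun i => (q i : ℝ) / placeValue n (i + 1)) y)
    (hy' : HasSum (fun i => (q' i : ℝ) / placeValue n (i + 1)) y') :
    |y - y'| ≤ 2 * K * |x - x'| ^ (τ : ℝ) := by
  by_cases hqq : q = q'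
  · subst hqq
    rw [hy.unique hy', sub_self, abs_zero]
    positivity
  have hex : ∃ i, q i ≠ q' i := Function.ne_iff.1 hqq
  classical
  set i := Nat.find hex with hi
  have hne : q i ≠ q' i := Nat.find_spec hex
  have heq : ∀ j < i, q j = q' j := fun j hj => not_not.1 (Nat.find_min hex hj)
  have hpv : ∀ k, (0 : ℝ) < placeValue n k := fun k => by exact_mod_cast placeValue_pos hn k
  have hX : |x - x' - t i * (d i (q i) - d i (q' i))| ≤ t i := by
    have h1 := hx.sub hx'
    simp only [← mul_sub] at h1
    refine h1.abs_sub_le_of_telescope (a := t) (fun k => (ht k).le)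
      (step_telescope hstep ht (z := fun i => d i (q i) - d i (q' i)) fun k => ?_) fun j hj => ?_
    · have h2 := hd k _ (hq k)
      have h3 := hd k _ (hq' k)
      rw [abs_le]; constructor <;> linarith
    · simp [heq j hj]
  have hY : |y - y' - ((q i : ℝ) - q' i) / placeValue n (i + 1)| ≤ 1 / placeValue n (i + 1) := by
    have h1 := hy.sub hy'
    simp only [← sub_div] at h1
    refine h1.abs_sub_le_of_telescope (a := fun k => 1 / (placeValue n (k + 1) : ℝ))
      (fun k => by positivity)
      (digit_telescope hn (z := fun i => (q i : ℝ) - q' i) fun k => ?_) fun j hj => ?_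
    · have h2 : (q k : ℝ) + 1 ≤ n k := by exact_mod_cast hq k
      have h3 : (q' k : ℝ) + 1 ≤ n k := by exact_mod_cast hq' k
      have h4 : (0 : ℝ) ≤ q k := Nat.cast_nonneg _
      have h5 : (0 : ℝ) ≤ q' k := Nat.cast_nonneg _
      rw [abs_le]; constructor <;> linarith
    · simp [heq j hj]
  set m : ℝ := |(q i : ℝ) - q' i| with hm
  have hm1 : 1 ≤ m := by
    have : (1 : ℤ) ≤ |(q i : ℤ) - q' i| := Int.one_le_abs (by omega)
    rw [hm]; exact_mod_cast this
  have hmn : m ≤ n i := by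
    have h2 : (q i : ℝ) ≤ n i := by exact_mod_cast (hq i).le
    have h3 : (q' i : ℝ) ≤ n i := by exact_mod_cast (hq' i).le
    have h4 : (0 : ℝ) ≤ q i := Nat.cast_nonneg _
    have h5 : (0 : ℝ) ≤ q' i := Nat.cast_nonneg _
    rw [hm, abs_le]; constructor <;> linarith
  have hxlow : t i * m ≤ |x - x'| := by
    have h1 := hsep i _ _ (hq i) (hq' i) hne
    have h2 := mul_le_mul_of_nonneg_left h1 (ht i).le
    have h3 : |t i * (d i (q i) - d i (q' i))| = t i * |d i (q i) - d i (q' i)| := by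
      rw [abs_mul, abs_of_pos (ht i)]
    have h4 := abs_sub_abs_le_abs_sub (t i * (d i (q i) - d i (q' i))) (x - x')
    rw [abs_sub_comm _ (x - x')] at h4
    linarith
  have hyup : |y - y'| ≤ 2 * m / placeValue n (i + 1) := by
    have h1 := abs_sub_abs_le_abs_sub (y - y') (((q i : ℝ) - q' i) / placeValue n (i + 1))
    rw [abs_div, Nat.abs_cast, ← hm] at h1
    have h2 : |y - y'| ≤ (1 + m) / placeValue n (i + 1) := by rw [add_div]; linarith
    exact h2.trans (div_le_div_of_nonneg_right (by linarith) (Nat.cast_nonneg _))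
  -- This trades `placeValue n (i + 1)` for `placeValue n i`, to which `hK` applies, and leaves the
  -- power of `m` that belongs to `t i * m`.
  have hmpow : m ≤ m ^ (τ : ℝ) * n i := by
    have h1 : m = m ^ (τ : ℝ) * m ^ (1 - (τ : ℝ)) := by
      rw [← Real.rpow_add (by linarith)]; simp
    have h2 : m ^ (1 - (τ : ℝ)) ≤ n i := by
      have : m ^ (1 - (τ : ℝ)) ≤ m ^ (1 : ℝ) :=
        Real.rpow_le_rpow_of_exponent_le hm1 (by linarith [τ.coe_nonneg])
      rw [Real.rpow_one] at this
      linarith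
    calc m = m ^ (τ : ℝ) * m ^ (1 - (τ : ℝ)) := h1
      _ ≤ _ := mul_le_mul_of_nonneg_left h2 (by positivity)
  have hni : (0 : ℝ) < n i := by exact_mod_cast hn i
  calc |y - y'| ≤ 2 * m / placeValue n (i + 1) := hyup
    _ ≤ 2 * (m ^ (τ : ℝ) * n i) / placeValue n (i + 1) := by gcongr
    _ = 2 * m ^ (τ : ℝ) * (1 / placeValue n i) := by
        have := hpv i
        rw [placeValue_succ]; push_cast; field_simp
    _ ≤ 2 * m ^ (τ : ℝ) * (K * t i ^ (τ : ℝ)) := by gcongr; exact hK i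
    _ = 2 * K * (t i * m) ^ (τ : ℝ) := by
        rw [Real.mul_rpow (ht i).le (by linarith)]; ring
    _ ≤ 2 * K * |x - x'| ^ (τ : ℝ) := by
        have := ht i
        gcongr

/-- A homogeneous Cantor set is mapped onto `[0, 1)` by a Hölder function that reads its digits in
the mixed radix system with bases `n i`. -/
theorem exists_holderOnWith_onto (ht : ∀ i, 0 < t i)
    (hstep : ∀ i, t (i + 1) * ((i : ℝ) + 2) ^ 4 ≤ t i) (hn : ∀ i, 1 ≤ n i)
    (hn2 : ∀ i, 2 ≤ n (i + 1))
    (hd : ∀ i q, q < n i → 0 ≤ d i q ∧ d i q ≤ ((i : ℝ) + 1) ^ 4 - 1)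
    (hsep : ∀ i q q', q < n i → q' < n i → q ≠ q' → |(q : ℝ) - q'| + 1 ≤ |d i q - d i q'|)
    {τ K : ℝ≥0} (hτ : 0 < τ) (hK : ∀ i, 1 / (placeValue n i : ℝ) ≤ K * t i ^ (τ : ℝ)) :
    ∃ f : ℝ → ℝ, HolderOnWith (2 * K) τ f
        {x | ∃ q : ℕ → ℕ, (∀ i, q i < n i) ∧ HasSum (fun i => t i * d i (q i)) x} ∧
      Ico 0 1 ⊆ f '' {x | ∃ q : ℕ → ℕ, (∀ i, q i < n i) ∧ HasSum (fun i => t i * d i (q i)) x} := by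
  have hsum : ∀ q : ℕ → ℕ, (∀ i, q i < n i) →
      Summable fun i => (q i : ℝ) / placeValue n (i + 1) := by
    intro q hq
    refine summable_of_telescope (a := fun k => 1 / (placeValue n (k + 1) : ℝ))
      (fun k => by positivity) (digit_telescope hn (z := fun i => (q i : ℝ)) fun k => ?_)
    have h2 : (q k : ℝ) + 1 ≤ n k := by exact_mod_cast hq k
    rw [Nat.abs_cast]; linarith
  have hex : ∀ x : ℝ, ∃ q : ℕ → ℕ, (∃ q : ℕ → ℕ, (∀ i, q i < n i) ∧
      HasSum (fun i => t i * d i (q i)) x) → (∀ i, q i < n i) ∧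
      HasSum (fun i => t i * d i (q i)) x := by
    intro x
    by_cases h : ∃ q : ℕ → ℕ, (∀ i, q i < n i) ∧ HasSum (fun i => t i * d i (q i)) x
    · exact ⟨h.choose, fun _ => h.choose_spec⟩
    · exact ⟨0, fun h' => absurd h' h⟩
  choose q hq using hex
  refine ⟨fun x => ∑' i, (q x i : ℝ) / placeValue n (i + 1), ?_, ?_⟩
  · intro x hx x' hx'
    have h1 := hq x hx
    have h2 := hq x' hx'
    have := holder_estimate ht hstep hn hd hsep hK h1.1 h2.1 h1.2 h2.2
      (hsum _ h1.1).hasSum (hsum _ h2.1).hasSum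
    rw [edist_dist, edist_dist, ENNReal.ofReal_rpow_of_nonneg dist_nonneg τ.coe_nonneg,
      ← ENNReal.ofReal_coe_nnreal, ← ENNReal.ofReal_mul (NNReal.coe_nonneg _)]
    refine ENNReal.ofReal_le_ofReal ?_
    rw [Real.dist_eq, Real.dist_eq]
    exact_mod_cast this
  · intro y hy
    obtain ⟨p, hp, hpy⟩ := exists_mixedRadix_expansion hn hn2 hy
    have hs : Summable fun i => t i * d i (p i) := by
      refine summable_of_telescope (fun k => (ht k).le)
        (step_telescope hstep ht (z := fun i => d i (p i)) fun k => ?_)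
      have := hd k _ (hp k)
      rw [abs_of_nonneg this.1]; exact this.2
    have hmem : ∃ q : ℕ → ℕ, (∀ i, q i < n i) ∧
      HasSum (fun i => t i * d i (q i)) (∑' i, t i * d i (p i)) := ⟨p, hp, hs.hasSum⟩
    refine ⟨_, hmem, ?_⟩
    have h1 := hq _ hmem
    -- With `x = x'` the estimate shows that the value of `f` does not depend on the digits chosen
    -- for `x`.
    have := holder_estimate ht hstep hn hd hsep hK h1.1 hp h1.2 hs.hasSum
      (hsum _ h1.1).hasSum hpy
    rw [sub_self, abs_zero, Real.zero_rpow (by exact_mod_cast hτ.ne'), mul_zero] at this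
    exact sub_eq_zero.1 (abs_nonpos_iff.1 this)

end Holder

/-! ### Factorial scales and their growth. -/

section Scales

/-- Raise `(C ^ (1 / ε)) ^ k ≤ k!` to the power `ε`. Every exponential factor below is absorbed in
this way. -/
theorem eventually_pow_le_factorial_rpow {C ε : ℝ} (hC : 0 < C) (hε : 0 < ε) :
    ∀ᶠ k : ℕ in atTop, C ^ k ≤ (k.factorial : ℝ) ^ ε := by
  have h := FloorSemiring.tendsto_pow_div_factorial_atTop (C ^ (1 / ε))
  filter_upwards [h.eventually (ge_mem_nhds one_pos)] with k hk
  have hf : (0 : ℝ) < k.factorial := by exact_mod_cast k.factorial_pos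
  rw [div_le_one hf] at hk
  have := Real.rpow_le_rpow (by positivity) hk hε.le
  rwa [← Real.rpow_natCast, ← Real.rpow_mul hC.le, ← Real.rpow_mul hC.le,
    show 1 / ε * k * ε = k by field_simp, Real.rpow_natCast] at this

theorem exists_forall_le_of_eventually_le {f : ℕ → ℝ} (h : ∀ᶠ i in atTop, f i ≤ 1) :
    ∃ K : ℝ≥0, ∀ i, f i ≤ K := by
  have hb : BddAbove (range f) := Filter.IsBoundedUnder.bddAbove_range ⟨1, by simpa using h⟩
  obtain ⟨K, hK⟩ := hb
  exact ⟨K.toNNReal, fun i => (hK ⟨i, rfl⟩).trans (Real.le_coe_toNNReal K)⟩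

/-- A sequence with limit `σ` that decreases slowly enough to keep `scale σ` summable for
`σ = 0`, too. -/
noncomputable def scaleWeight (σ : ℝ) (i : ℕ) : ℝ := max σ (1 / ((i : ℝ) + 1))

/-- The scales `(i + 1)! ^ (-4 / w i)` with weights `w i` that tend to `σ`. -/
noncomputable def scale (σ : ℝ) (i : ℕ) : ℝ := ((i + 1).factorial : ℝ) ^ (-(4 / scaleWeight σ i))

theorem scaleWeight_pos (σ : ℝ) (i : ℕ) : 0 < scaleWeight σ i :=
  lt_max_of_lt_right (by positivity)

theorem scaleWeight_le_one {σ : ℝ} (hσ : σ ≤ 1) (i : ℕ) : scaleWeight σ i ≤ 1 :=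
  max_le hσ ((div_le_one (by positivity)).2 (by linarith [Nat.cast_nonneg (α := ℝ) i]))

theorem scaleWeight_succ_le (σ : ℝ) (i : ℕ) : scaleWeight σ (i + 1) ≤ scaleWeight σ i := by
  refine max_le_max le_rfl (one_div_le_one_div_of_le (by positivity) ?_)
  push_cast; linarith

theorem eventually_scaleWeight_le {σ w : ℝ} (h : σ < w) (hw : 0 < w) :
    ∀ᶠ i in atTop, scaleWeight σ i ≤ w := by
  filter_upwards [tendsto_one_div_add_atTop_nhds_zero_nat.eventually (ge_mem_nhds hw)] with i hi
  exact max_le h.le hi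

theorem scale_pos (σ : ℝ) (i : ℕ) : 0 < scale σ i :=
  Real.rpow_pos_of_pos (by exact_mod_cast Nat.factorial_pos _) _

theorem scale_step {σ : ℝ} (hσ : σ ≤ 1) (i : ℕ) :
    scale σ (i + 1) * ((i : ℝ) + 2) ^ 4 ≤ scale σ i := by
  have hf : (1 : ℝ) ≤ (i + 1).factorial := by exact_mod_cast Nat.succ_le_of_lt (Nat.factorial_pos _)
  have hf2 : (1 : ℝ) ≤ (i + 1 + 1).factorial := by
    exact_mod_cast Nat.succ_le_of_lt (Nat.factorial_pos _)
  have h2 : (1 : ℝ) ≤ i + 2 := by linarith [Nat.cast_nonneg (α := ℝ) i]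
  have hw := scaleWeight_pos σ i
  have hw1 := scaleWeight_le_one hσ i
  have h1 : scale σ (i + 1) ≤ ((i + 1 + 1).factorial : ℝ) ^ (-(4 / scaleWeight σ i)) := by
    refine Real.rpow_le_rpow_of_exponent_le hf2 (neg_le_neg ?_)
    exact div_le_div_of_nonneg_left (by norm_num) (scaleWeight_pos σ _) (scaleWeight_succ_le σ i)
  have h3 : ((i + 1 + 1).factorial : ℝ) ^ (-(4 / scaleWeight σ i))
      = ((i : ℝ) + 2) ^ (-(4 / scaleWeight σ i)) * scale σ i := by
    rw [scale, ← Real.mul_rpow (by linarith) (by linarith), Nat.factorial_succ (i + 1)]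
    push_cast
    ring_nf
  have h4 : ((i : ℝ) + 2) ^ (-(4 / scaleWeight σ i)) ≤ ((i : ℝ) + 2) ^ (-4 : ℝ) := by
    refine Real.rpow_le_rpow_of_exponent_le h2 (neg_le_neg ?_)
    rw [le_div_iff₀ hw]; linarith
  have h5 : ((i : ℝ) + 2) ^ (-4 : ℝ) * ((i : ℝ) + 2) ^ 4 = 1 := by
    rw [show (-4 : ℝ) = -((4 : ℕ) : ℝ) by norm_num, Real.rpow_neg (by linarith),
      Real.rpow_natCast]
    exact inv_mul_cancel₀ (by positivity)
  calc scale σ (i + 1) * ((i : ℝ) + 2) ^ 4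
      ≤ ((i : ℝ) + 2) ^ (-4 : ℝ) * scale σ i * ((i : ℝ) + 2) ^ 4 := by
        have := scale_pos σ i
        gcongr
        exact h1.trans (h3.le.trans (by gcongr))
    _ = (((i : ℝ) + 2) ^ (-4 : ℝ) * ((i : ℝ) + 2) ^ 4) * scale σ i := by ring
    _ = scale σ i := by rw [h5, one_mul]

theorem le_scale_rpow {σ τ : ℝ} (hσ : 0 < σ) (hτ : 0 < τ) (i : ℕ) :
    ((i + 1).factorial : ℝ) ^ (-(4 * τ / σ)) ≤ scale σ i ^ τ := by
  rw [scale, ← Real.rpow_mul (by positivity)]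
  refine Real.rpow_le_rpow_of_exponent_le
    (by exact_mod_cast Nat.succ_le_of_lt (Nat.factorial_pos _)) ?_
  rw [neg_mul, neg_le_neg_iff, div_mul_eq_mul_div]
  exact div_le_div_of_nonneg_left (by positivity) hσ (le_max_left _ _)

/-- The numbers of cylinders `placeValue n i ≥ (i!) ^ m / 2 ^ i` satisfy the condition of
`exists_holderOnWith_onto` for the exponents below `m * σ / 4`. -/
theorem exists_const_one_div_placeValue_le {σ τ : ℝ} (hσ : 0 < σ) (hτ : 0 < τ) {m : ℕ}
    (hτm : τ < m * σ / 4) {n : ℕ → ℕ} (hnm : ∀ i, (i + 1) ^ m ≤ 2 * n i) :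
    ∃ K : ℝ≥0, ∀ i, 1 / (placeValue n i : ℝ) ≤ K * scale σ i ^ τ := by
  have hpl : ∀ i, i.factorial ^ m ≤ 2 ^ i * placeValue n i := by
    intro i
    induction i with
    | zero => simp [placeValue]
    | succ i ih =>
      calc (i + 1).factorial ^ m = (i + 1) ^ m * i.factorial ^ m := by
            rw [Nat.factorial_succ, mul_pow]
        _ ≤ (2 * n i) * (2 ^ i * placeValue n i) := Nat.mul_le_mul (hnm i) ih
        _ = _ := by rw [placeValue_succ]; ring
  have hppos : ∀ i, (0 : ℝ) < placeValue n i := by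
    intro i
    have h1 : 0 < i.factorial ^ m := pow_pos i.factorial_pos m
    have h2 := hpl i
    have : 0 < placeValue n i := by
      rcases Nat.eq_zero_or_pos (placeValue n i) with h | h
      · rw [h, mul_zero] at h2; omega
      · exact h
    exact_mod_cast this
  -- By `le_scale_rpow`, `scale σ i ^ τ` is at least `(i + 1)! ^ (-m')`. The gap `m - m' > 0`
  -- absorbs `2 ^ i` and the passage from `i!` to `(i + 1)!`.
  set m' := 4 * τ / σ with hm'
  have hm'0 : 0 < m' := by positivity
  have hm'm : 0 < m - m' := by
    rw [sub_pos, hm', div_lt_iff₀ hσ]; linarith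
  have hev : ∀ᶠ i : ℕ in atTop, 1 / (placeValue n i : ℝ) / scale σ i ^ τ ≤ 1 := by
    filter_upwards [eventually_pow_le_factorial_rpow (C := 2 ^ m' * 2) (by positivity) hm'm]
      with i hi
    have hf : (0 : ℝ) < i.factorial := by exact_mod_cast i.factorial_pos
    have hf1 : (0 : ℝ) < (i + 1).factorial := by exact_mod_cast (i + 1).factorial_pos
    have h1 := le_scale_rpow hσ hτ i
    rw [div_le_one (Real.rpow_pos_of_pos (scale_pos σ i) _)]
    refine le_trans ?_ h1
    rw [Real.rpow_neg hf1.le, one_div, ← hm']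
    refine inv_anti₀ (Real.rpow_pos_of_pos hf1 _) ?_
    have h2 : ((i + 1).factorial : ℝ) ^ m' ≤ (2 ^ m') ^ i * (i.factorial : ℝ) ^ m' := by
      rw [← Real.rpow_natCast (2 ^ m'), ← Real.rpow_mul (by norm_num), mul_comm m',
        Real.rpow_mul (by norm_num), ← Real.mul_rpow (by positivity) hf.le]
      refine Real.rpow_le_rpow hf1.le ?_ hm'0.le
      rw [Nat.factorial_succ, Real.rpow_natCast]
      push_cast
      gcongr
      exact_mod_cast (Nat.lt_two_pow_self (n := i))
    have h3 : ((2 : ℝ) ^ m') ^ i * (i.factorial : ℝ) ^ m' * 2 ^ i ≤ (i.factorial : ℝ) ^ m := by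
      calc ((2 : ℝ) ^ m') ^ i * (i.factorial : ℝ) ^ m' * 2 ^ i
          = (2 ^ m' * 2) ^ i * (i.factorial : ℝ) ^ m' := by rw [mul_pow]; ring
        _ ≤ (i.factorial : ℝ) ^ (m - m') * (i.factorial : ℝ) ^ m' := by gcongr
        _ = (i.factorial : ℝ) ^ m := by
          rw [← Real.rpow_add hf, sub_add_cancel, Real.rpow_natCast]
    have h4 : (i.factorial : ℝ) ^ m ≤ placeValue n i * 2 ^ i := by
      rw [mul_comm]; exact_mod_cast hpl i
    refine le_of_mul_le_mul_right ?_ (show (0 : ℝ) < 2 ^ i by positivity)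
    exact (mul_le_mul_of_nonneg_right h2 (by positivity)).trans (h3.trans h4)
  obtain ⟨K, hK⟩ := exists_forall_le_of_eventually_le hev
  refine ⟨K, fun i => ?_⟩
  have := hK i
  rwa [div_le_iff₀ (Real.rpow_pos_of_pos (scale_pos σ i) _)] at this

/-- The index `k + 2` on the left serves radii between `4 * scale σ (k + 1)` and `4 * scale σ k`,
whose covers use `k + 2` digits. Choosing `w` between `σ` and `4 * s / m` makes the exponent `4 * s
/ w` exceed `m`; the surplus absorbs all exponential factors. -/
theorem eventually_pow_mul_factorial_le_scale {σ s C : ℝ} (hC : 1 ≤ C) (hσ : 0 ≤ σ) {m : ℕ}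
    (hm : 0 < m) (hs : m * σ / 4 < s) :
    ∀ᶠ k : ℕ in atTop, C ^ (k + 2) * ((k + 2).factorial : ℝ) ^ m ≤ (4 * scale σ k) ^ (-s) := by
  have hm0 : (0 : ℝ) < m := by exact_mod_cast hm
  have hs0 : 0 < s := lt_of_le_of_lt (by positivity) hs
  obtain ⟨w, hw1, hw2⟩ := exists_between (show σ < 4 * s / m by rw [lt_div_iff₀ hm0]; linarith)
  have hw0 : 0 < w := lt_of_le_of_lt hσ hw1
  have hp : 0 < 4 * s / w - m := by
    rw [sub_pos, lt_div_iff₀ hw0]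
    rw [lt_div_iff₀ hm0] at hw2
    linarith
  have h4 : (1 : ℝ) ≤ 4 ^ s := Real.one_le_rpow (by norm_num) hs0.le
  have hgrow := (tendsto_add_atTop_nat 1).eventually (eventually_pow_le_factorial_rpow
    (C := C * C * 4 ^ s * 2 ^ m) (by positivity) hp)
  filter_upwards [hgrow, eventually_scaleWeight_le hw1 hw0] with k hk hwk
  have hf : (0 : ℝ) < (k + 1).factorial := by exact_mod_cast (k + 1).factorial_pos
  have hf1 : (1 : ℝ) ≤ (k + 1).factorial := by
    exact_mod_cast Nat.succ_le_of_lt (Nat.factorial_pos _)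
  have h1 : (4 * scale σ k) ^ (-s) = 4 ^ (-s) * ((k + 1).factorial : ℝ) ^ (4 * s / scaleWeight σ k) := by
    rw [Real.mul_rpow (by norm_num) (scale_pos σ k).le, scale, ← Real.rpow_mul hf.le]
    congr 2
    ring
  have h2 : ((k + 1).factorial : ℝ) ^ (4 * s / w)
      ≤ ((k + 1).factorial : ℝ) ^ (4 * s / scaleWeight σ k) := by
    refine Real.rpow_le_rpow_of_exponent_le hf1 ?_
    exact div_le_div_of_nonneg_left (by positivity) (scaleWeight_pos σ k) hwk
  have h3 : ((k + 2).factorial : ℝ) ^ m ≤ (2 ^ m) ^ (k + 1) * ((k + 1).factorial : ℝ) ^ m := by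
    rw [← pow_mul, mul_comm m, pow_mul, ← mul_pow]
    refine pow_le_pow_left₀ (by positivity) ?_ m
    rw [Nat.factorial_succ (k + 1)]
    push_cast
    gcongr
    exact_mod_cast (Nat.lt_two_pow_self (n := k + 1))
  have h5 : C ^ (k + 2) ≤ 4 ^ (-s) * (C * C * 4 ^ s) ^ (k + 1) := by
    have e1 : C ^ (k + 2) ≤ (C * C) ^ (k + 1) := by
      rw [← pow_two, ← pow_mul]
      exact pow_le_pow_right₀ hC (by omega)
    have e2 : (1 : ℝ) ≤ 4 ^ (-s) * (4 ^ s) ^ (k + 1) := by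
      rw [pow_succ', ← mul_assoc, ← Real.rpow_add (by norm_num), neg_add_cancel, Real.rpow_zero,
        one_mul]
      exact one_le_pow₀ h4
    calc C ^ (k + 2) ≤ (C * C) ^ (k + 1) * 1 := by rw [mul_one]; exact e1
      _ ≤ (C * C) ^ (k + 1) * (4 ^ (-s) * (4 ^ s) ^ (k + 1)) := by gcongr
      _ = _ := by rw [mul_pow _ ((4 : ℝ) ^ s)]; ring
  rw [h1]
  calc C ^ (k + 2) * ((k + 2).factorial : ℝ) ^ m
      ≤ (4 ^ (-s) * (C * C * 4 ^ s) ^ (k + 1)) * ((2 ^ m) ^ (k + 1) * ((k + 1).factorial : ℝ) ^ m) := by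
        gcongr
    _ = 4 ^ (-s) * ((C * C * 4 ^ s * 2 ^ m) ^ (k + 1) * ((k + 1).factorial : ℝ) ^ m) := by
        rw [mul_pow _ ((2 : ℝ) ^ m)]; ring
    _ ≤ 4 ^ (-s) * (((k + 1).factorial : ℝ) ^ (4 * s / w - m) * ((k + 1).factorial : ℝ) ^ m) := by
        gcongr
    _ = 4 ^ (-s) * ((k + 1).factorial : ℝ) ^ (4 * s / w) := by
        rw [← Real.rpow_natCast _ m, ← Real.rpow_add hf, sub_add_cancel]
    _ ≤ _ := by gcongr

end Scales

/-! ### Compactness and dimensions of infinite sumsets. -/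

section Sumsets

variable {t : ℕ → ℝ} {W : ℕ → Finset ℝ}

theorem two_le_add_two_pow_four (k : ℕ) : (2 : ℝ) ≤ ((k : ℝ) + 2) ^ 4 :=
  calc (2 : ℝ) ≤ 2 ^ 4 := by norm_num
    _ ≤ ((k : ℝ) + 2) ^ 4 := by
      gcongr
      linarith [Nat.cast_nonneg (α := ℝ) k]

theorem summable_scale_mul (ht : ∀ i, 0 < t i)
    (hstep : ∀ i, t (i + 1) * ((i : ℝ) + 2) ^ 4 ≤ t i) :
    Summable fun i => t i * ((i : ℝ) + 1) ^ 4 := by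
  refine summable_of_telescope (a := fun i => 2 * t i) (fun i => by have := ht i; positivity)
    fun k => ?_
  have h1 := hstep k
  have h2 := two_le_add_two_pow_four k
  have h3 := mul_le_mul_of_nonneg_left h2 (ht (k + 1)).le
  have := ht (k + 1)
  push_cast
  rw [show (k : ℝ) + 1 + 1 = k + 2 by ring, abs_of_pos (by positivity)]
  linarith

theorem summable_scaled_digits (ht : ∀ i, 0 < t i)
    (hstep : ∀ i, t (i + 1) * ((i : ℝ) + 2) ^ 4 ≤ t i) {q : ℕ → ℝ} {c : ℝ}
    (hq : ∀ i, |q i| ≤ c * ((i : ℝ) + 1) ^ 4) : Summable fun i => t i * q i := by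
  refine Summable.of_norm_bounded ((summable_scale_mul ht hstep).mul_left c) fun i => ?_
  rw [Real.norm_eq_abs, abs_mul, abs_of_pos (ht i)]
  calc t i * |q i| ≤ t i * (c * ((i : ℝ) + 1) ^ 4) :=
        mul_le_mul_of_nonneg_left (hq i) (ht i).le
    _ = _ := by ring

theorem mem_infiniteSumset_image {W : ℕ → Set ℝ} {x : ℝ} :
    x ∈ infiniteSumset (fun k => (fun x => t k * x) '' W k) ↔
      ∃ q : ℕ → ℝ, (∀ i, q i ∈ W i) ∧ HasSum (fun i => t i * q i) x := by
  constructor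
  · rintro ⟨q, hq, hx⟩
    choose p hp hpq using hq
    refine ⟨p, hp, ?_⟩
    simpa only [hpq] using hx
  · rintro ⟨q, hq, hx⟩
    exact ⟨_, fun i => ⟨q i, hq i, rfl⟩, hx⟩

/-- The sumset is a continuous image of a product of finite sets. -/
theorem isCompact_infiniteSumset (ht : ∀ i, 0 < t i)
    (hstep : ∀ i, t (i + 1) * ((i : ℝ) + 2) ^ 4 ≤ t i)
    (hW : ∀ i, ∀ x ∈ W i, |x| ≤ 2 * ((i : ℝ) + 1) ^ 4) :
    IsCompact (infiniteSumset (fun k => (fun x => t k * x) '' (W k : Set ℝ))) := by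
  have hcomp : IsCompact (Set.univ.pi fun i => (W i : Set ℝ)) :=
    isCompact_univ_pi fun i => (W i).finite_toSet.isCompact
  have hcont : ContinuousOn (fun q : ℕ → ℝ => ∑' i, t i * q i)
      (Set.univ.pi fun i => (W i : Set ℝ)) := by
    refine continuousOn_tsum (u := fun i => 2 * (t i * ((i : ℝ) + 1) ^ 4))
      (fun i => (continuous_const.mul (continuous_apply i)).continuousOn)
      ((summable_scale_mul ht hstep).mul_left 2) fun i q hq => ?_
    rw [Real.norm_eq_abs, abs_mul, abs_of_pos (ht i)]
    calc t i * |q i| ≤ t i * (2 * ((i : ℝ) + 1) ^ 4) :=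
          mul_le_mul_of_nonneg_left (hW i _ (hq i (mem_univ i))) (ht i).le
      _ = _ := by ring
  convert hcomp.image_of_continuousOn hcont using 1
  ext x
  rw [mem_infiniteSumset_image]
  constructor
  · rintro ⟨q, hq, hx⟩
    exact ⟨q, fun i _ => hq i, hx.tsum_eq⟩
  · rintro ⟨q, hq, rfl⟩
    exact ⟨q, fun i => hq i (mem_univ i), (summable_scaled_digits ht hstep
      fun i => hW i _ (hq i (mem_univ i))).hasSum⟩

open scoped Classical in
theorem exists_finset_partialSums {C m : ℕ} (hcard : ∀ i, (W i).card ≤ C * (i + 1) ^ m) (k : ℕ) :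
    ∃ T : Finset ℝ, T.card ≤ C ^ k * k.factorial ^ m ∧
      ∀ q : ℕ → ℝ, (∀ i, q i ∈ W i) → ∑ i ∈ Finset.range k, t i * q i ∈ T := by
  induction k with
  | zero => exact ⟨{0}, by simp, by simp⟩
  | succ k ih =>
    obtain ⟨T, hT, hT'⟩ := ih
    refine ⟨Finset.image₂ (fun s x => s + t k * x) T (W k), ?_, fun q hq => ?_⟩
    · refine (Finset.card_image₂_le _ _ _).trans ((Nat.mul_le_mul hT (hcard k)).trans (le_of_eq ?_))
      rw [Nat.factorial_succ, mul_pow]; ring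
    · rw [Finset.sum_range_succ]
      exact Finset.mem_image₂_of_mem (hT' q hq) (hq k)

theorem exists_finset_cover (ht : ∀ i, 0 < t i)
    (hstep : ∀ i, t (i + 1) * ((i : ℝ) + 2) ^ 4 ≤ t i) {C m : ℕ}
    (hcard : ∀ i, (W i).card ≤ C * (i + 1) ^ m)
    (hW : ∀ i, ∀ x ∈ W i, |x| ≤ 2 * ((i : ℝ) + 1) ^ 4) (k : ℕ) :
    ∃ T : Finset ℝ, T.card ≤ C ^ (k + 1) * (k + 1).factorial ^ m ∧
      ∀ x ∈ infiniteSumset (fun k => (fun x => t k * x) '' (W k : Set ℝ)),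
        ∃ c ∈ T, dist x c ≤ 4 * t k := by
  obtain ⟨T, hT, hT'⟩ := exists_finset_partialSums (t := t) hcard (k + 1)
  refine ⟨T, hT, fun x hx => ?_⟩
  obtain ⟨q, hq, hx⟩ := mem_infiniteSumset_image.1 hx
  refine ⟨_, hT' q hq, ?_⟩
  rw [Real.dist_eq]
  -- The next term is at most `2 * t k`, and `2 * t (k + 1) ≤ t k` makes this at most `4 * t k - 4 *
  -- t (k + 1)`.
  refine hx.abs_sub_sum_range_le_of_telescope (a := fun k => 4 * t k)
    (fun k => by have := ht k; positivity) (fun k => ?_) k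
  have h1 := hstep k
  have h2 := two_le_add_two_pow_four k
  have h3 := mul_le_mul_of_nonneg_left h2 (ht (k + 1)).le
  have h4 := mul_le_mul_of_nonneg_left (hW (k + 1) _ (hq (k + 1))) (ht (k + 1)).le
  push_cast at h4
  rw [show (k : ℝ) + 1 + 1 = k + 2 by ring] at h4
  rw [abs_mul, abs_of_pos (ht _)]
  linarith

theorem tendsto_scale_zero (ht : ∀ i, 0 < t i)
    (hstep : ∀ i, t (i + 1) * ((i : ℝ) + 2) ^ 4 ≤ t i) : Tendsto t atTop (𝓝 0) := by
  have h := (summable_scale_mul ht hstep).tendsto_atTop_zero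
  refine squeeze_zero (fun i => (ht i).le) (fun i => ?_) h
  refine le_mul_of_one_le_right (ht i).le (one_le_pow₀ ?_)
  linarith [Nat.cast_nonneg (α := ℝ) i]

theorem antitone_of_step (ht : ∀ i, 0 < t i)
    (hstep : ∀ i, t (i + 1) * ((i : ℝ) + 2) ^ 4 ≤ t i) : Antitone t := by
  refine antitone_nat_of_succ_le fun i => le_trans ?_ (hstep i)
  refine le_mul_of_one_le_right (ht _).le (one_le_pow₀ ?_)
  linarith [Nat.cast_nonneg (α := ℝ) i]

theorem coverBound_infiniteSumset {σ : ℝ} (hσ0 : 0 ≤ σ) (hσ1 : σ ≤ 1) {C m : ℕ} (hC : 1 ≤ C)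
    (hm : 0 < m) (hcard : ∀ i, (W i).card ≤ C * (i + 1) ^ m)
    (hW : ∀ i, ∀ x ∈ W i, |x| ≤ 2 * ((i : ℝ) + 1) ^ 4) :
    CoverBound (infiniteSumset (fun k => (fun x => scale σ k * x) '' (W k : Set ℝ)))
      (m * σ / 4) := by
  intro s hs
  have ht := scale_pos σ
  have hstep := scale_step hσ1
  have hs0 : 0 < s := lt_of_le_of_lt (by positivity) hs
  obtain ⟨k₀, hk₀⟩ := eventually_atTop.1 (eventually_pow_mul_factorial_le_scale
    (C := C) (by exact_mod_cast hC) hσ0 hm hs)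
  have hpos : 0 < 4 * scale σ k₀ := by have := ht k₀; positivity
  filter_upwards [self_mem_nhdsWithin, mem_nhdsWithin_of_mem_nhds (Iio_mem_nhds hpos)] with δ h1 h2
  have h1 : 0 < δ := h1
  have h2 : δ < 4 * scale σ k₀ := h2
  have hex : ∃ k, 4 * scale σ k ≤ δ := by
    have := (tendsto_scale_zero ht hstep).const_mul 4
    rw [mul_zero] at this
    exact (this.eventually (ge_mem_nhds h1)).exists
  classical
  -- The first index with `4 * scale σ k ≤ δ` is used; its predecessor exceeds `δ` and is still at
  -- least `k₀`, so the growth estimate applies to it.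
  obtain ⟨j, hj⟩ : ∃ j, Nat.find hex = k₀ + j + 1 := by
    have : k₀ < Nat.find hex := by
      by_contra hcon
      have h3 := antitone_of_step ht hstep (not_lt.1 hcon)
      linarith [Nat.find_spec hex]
    exact ⟨Nat.find hex - k₀ - 1, by omega⟩
  have h3 : 4 * scale σ (k₀ + j + 1) ≤ δ := hj ▸ Nat.find_spec hex
  have h4 : δ < 4 * scale σ (k₀ + j) := not_le.1 (Nat.find_min hex (by omega))
  obtain ⟨T, hT, hT'⟩ := exists_finset_cover ht hstep hcard hW (k₀ + j + 1)
  refine ⟨T, ?_, fun x hx => ?_⟩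
  · have h5 : (T.card : ℝ) ≤ C ^ (k₀ + j + 2) * ((k₀ + j + 2).factorial : ℝ) ^ m := by
      exact_mod_cast hT
    exact h5.trans ((hk₀ _ (Nat.le_add_right _ _)).trans
      (Real.rpow_le_rpow_of_nonpos h1 h4.le (by linarith)))
  · obtain ⟨c, hc, hxc⟩ := hT' x hx
    exact ⟨c, hc, hxc.trans h3⟩

/-- Dimensions of an infinite sumset with digit sets of about `(i + 1) ^ m` elements, many of
which are separated. -/
theorem infiniteSumset_dimensions {σ : ℝ} (hσ0 : 0 ≤ σ) (hσ1 : σ ≤ 1) {C m : ℕ} (hC : 1 ≤ C)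
    (hm : 0 < m) (hcard : ∀ i, (W i).card ≤ C * (i + 1) ^ m)
    (hW : ∀ i, ∀ x ∈ W i, |x| ≤ 2 * ((i : ℝ) + 1) ^ 4) {n : ℕ → ℕ} {d : ℕ → ℕ → ℝ}
    (hnm : ∀ i, (i + 1) ^ m ≤ 2 * n i) (hn2 : ∀ i, 2 ≤ n (i + 1))
    (hdW : ∀ i q, q < n i → d i q ∈ W i)
    (hd : ∀ i q, q < n i → 0 ≤ d i q ∧ d i q ≤ ((i : ℝ) + 1) ^ 4 - 1)
    (hsep : ∀ i q q', q < n i → q' < n i → q ≠ q' → |(q : ℝ) - q'| + 1 ≤ |d i q - d i q'|)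
    {E : Set ℝ} (hE : E = infiniteSumset (fun k => (fun x => scale σ k * x) '' (W k : Set ℝ))) :
    (dimH E = ENNReal.ofReal (m * σ / 4) ∧ HasBoxDim E (m * σ / 4) ∧
      packingDim E = ENNReal.ofReal (m * σ / 4)) ∧
    (dimH (planeProd E E) = ENNReal.ofReal (2 * (m * σ / 4)) ∧
      HasBoxDim (planeProd E E) (2 * (m * σ / 4)) ∧
      packingDim (planeProd E E) = ENNReal.ofReal (2 * (m * σ / 4))) := by
  subst hE
  set E := infiniteSumset (fun k => (fun x => scale σ k * x) '' (W k : Set ℝ)) with hE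
  have ht := scale_pos σ
  have hstep := scale_step hσ1
  have hn : ∀ i, 1 ≤ n i := fun i => by
    have := Nat.one_le_pow m (i + 1) (Nat.succ_pos i)
    have := hnm i
    omega
  have hcov : CoverBound E (m * σ / 4) := coverBound_infiniteSumset hσ0 hσ1 hC hm hcard hW
  have hne : E.Nonempty :=
    ⟨_, mem_infiniteSumset_image.2 ⟨fun i => d i 0, fun i => hdW i 0 (hn i),
      (summable_scaled_digits ht hstep fun i => hW i _ (hdW i 0 (hn i))).hasSum⟩⟩
  have hne2 : (planeProd E E).Nonempty := by
    obtain ⟨x, hx⟩ := hne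
    exact ⟨!₂[x, x], by simpa using hx, by simpa using hx⟩
  -- The lower bound needs only this subset, whose digits are separated; the full digit sets may
  -- cluster.
  set P := {x | ∃ q : ℕ → ℕ, (∀ i, q i < n i) ∧ HasSum (fun i => scale σ i * d i (q i)) x} with hP
  have hPE : P ⊆ E := by
    rintro x ⟨q, hq, hx⟩
    exact mem_infiniteSumset_image.2 ⟨fun i => d i (q i), fun i => hdW i _ (hq i), hx⟩
  have hPE2 : planeProd P P ⊆ planeProd E E := fun p hp => ⟨hPE hp.1, hPE hp.2⟩
  have hholder : ∀ τ : ℝ≥0, 0 < τ → (τ : ℝ) < m * σ / 4 →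
      ∃ (K : ℝ≥0) (f : ℝ → ℝ), HolderOnWith K τ f P ∧ Ico 0 1 ⊆ f '' P := by
    intro τ hτ hτm
    have hτ' : (0 : ℝ) < τ := hτ
    have hσ : 0 < σ := by
      rcases hσ0.eq_or_lt with h | h
      · rw [← h] at hτm; simp at hτm
      · exact h
    obtain ⟨K, hK⟩ := exists_const_one_div_placeValue_le hσ hτ' hτm hnm
    exact ⟨_, exists_holderOnWith_onto ht hstep hn hn2 hd hsep hτ hK⟩
  refine ⟨dimensions_eq hne hcov ?_, dimensions_eq hne2 hcov.planeProd ?_⟩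
  · refine ENNReal.le_of_forall_nnreal_lt fun τ hτ => ?_
    rcases eq_or_ne τ 0 with rfl | h0
    · simp
    rw [← ENNReal.ofReal_coe_nnreal, ENNReal.ofReal_lt_ofReal_iff'] at hτ
    obtain ⟨K, f, hf, hf'⟩ := hholder τ (pos_iff_ne_zero.2 h0) hτ.1
    exact (le_dimH_of_holderOnWith (pos_iff_ne_zero.2 h0) hf hf').trans (dimH_mono hPE)
  · refine ENNReal.le_of_forall_nnreal_lt fun τ hτ => ?_
    rcases eq_or_ne τ 0 with rfl | h0
    · simp
    rw [← ENNReal.ofReal_coe_nnreal, ENNReal.ofReal_lt_ofReal_iff'] at hτ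
    have h2 : 0 < τ / 2 := by have := pos_iff_ne_zero.2 h0; positivity
    obtain ⟨K, f, hf, hf'⟩ := hholder (τ / 2) h2 (by push_cast; linarith)
    refine le_trans (le_of_eq ?_)
      ((two_mul_le_dimH_planeProd h2 hf hf').trans (dimH_mono hPE2))
    rw [show (2 : ℝ≥0∞) = ((2 : ℝ≥0) : ℝ≥0∞) by norm_num, ← ENNReal.coe_mul]
    congr 1
    field_simp

end Sumsets

/-! ### Arithmetic of the digit sets and the common radius. -/

section Digits

theorem abs_le_of_mem_digitSet {k : ℕ} (hk : 1 ≤ k) {x : ℝ} (hx : x ∈ digitSet k) :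
    |x| ≤ 2 * (k : ℝ) ^ 4 := by
  obtain ⟨a, b, c, d, ha, hb, hc, hd, -, rfl⟩ := hx
  have hk0 : (1 : ℝ) ≤ k := by exact_mod_cast hk
  have bound : ∀ e : ℤ, e ∈ Icc (-(k : ℤ) + 1) (2 * k - 2) → |(e : ℝ)| ≤ 2 * (k - 1) := by
    intro e he
    have h1 : -(k : ℝ) + 1 ≤ e := by exact_mod_cast he.1
    have h2 : (e : ℝ) ≤ 2 * k - 2 := by exact_mod_cast he.2
    rw [abs_le]
    constructor <;> linarith
  have hmul : ∀ (e : ℤ) (j : ℕ), e ∈ Icc (-(k : ℤ) + 1) (2 * k - 2) →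
      |(e : ℝ) * (k : ℝ) ^ j| ≤ 2 * (k - 1) * (k : ℝ) ^ j := by
    intro e j he
    rw [abs_mul, abs_of_nonneg (show (0 : ℝ) ≤ (k : ℝ) ^ j by positivity)]
    exact mul_le_mul_of_nonneg_right (bound e he) (by positivity)
  have h0 := bound a ha
  have h1 := hmul b 1 hb
  have h2 := hmul c 2 hc
  have h3 := hmul d 3 hd
  rw [pow_one] at h1
  have e1 := abs_add_le ((a : ℝ) + b * k + c * k ^ 2) (d * k ^ 3)
  have e2 := abs_add_le ((a : ℝ) + b * k) (c * k ^ 2)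
  have e3 := abs_add_le (a : ℝ) (b * k)
  have e4 : 2 * ((k : ℝ) - 1) + 2 * (k - 1) * k + 2 * (k - 1) * k ^ 2 + 2 * (k - 1) * k ^ 3
      = 2 * (k : ℝ) ^ 4 - 2 := by ring
  linarith

-- Four choices for the vanishing coefficient and at most `3 * k` values for each of the other three
-- give `4 * 27 * k ^ 3`.
open scoped Classical in
theorem exists_finset_digitSet {k : ℕ} (hk : 1 ≤ k) :
    ∃ F : Finset ℝ, F.card ≤ 108 * k ^ 3 ∧ (F : Set ℝ) = digitSet k := by
  set I : Finset ℤ := Finset.Icc (-(k : ℤ) + 1) (2 * k - 2) with hI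
  have hIcard : I.card ≤ 3 * k := by
    rw [hI, Int.card_Icc]; omega
  let g : Fin 4 × ℤ × ℤ × ℤ → ℝ := fun p =>
    ![p.2.1 * (k : ℝ) + p.2.2.1 * k ^ 2 + p.2.2.2 * k ^ 3,
      p.2.1 + p.2.2.1 * (k : ℝ) ^ 2 + p.2.2.2 * k ^ 3,
      p.2.1 + p.2.2.1 * (k : ℝ) + p.2.2.2 * k ^ 3,
      p.2.1 + p.2.2.1 * (k : ℝ) + p.2.2.2 * k ^ 2] p.1
  set G : Finset ℝ := ((Finset.univ : Finset (Fin 4)) ×ˢ I ×ˢ I ×ˢ I).image g with hG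
  have hsub : digitSet k ⊆ G := by
    rintro x ⟨a, b, c, d, ha, hb, hc, hd, h0, rfl⟩
    have ha : a ∈ I := Finset.mem_Icc.2 ha
    have hb : b ∈ I := Finset.mem_Icc.2 hb
    have hc : c ∈ I := Finset.mem_Icc.2 hc
    have hd : d ∈ I := Finset.mem_Icc.2 hd
    simp only [mul_eq_zero] at h0
    rw [hG, Finset.coe_image]
    rcases h0 with ((rfl | rfl) | rfl) | rfl
    · exact ⟨(0, b, c, d), by simp [hb, hc, hd], by simp [g]⟩
    · exact ⟨(1, a, c, d), by simp [ha, hc, hd], by simp [g]⟩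
    · exact ⟨(2, a, b, d), by simp [ha, hb, hd], by simp [g]⟩
    · exact ⟨(3, a, b, c), by simp [ha, hb, hc], by simp [g]⟩
  have hfin : (digitSet k).Finite := G.finite_toSet.subset hsub
  refine ⟨hfin.toFinset, ?_, by simp⟩
  calc hfin.toFinset.card ≤ G.card := Finset.card_le_card (by simpa using hsub)
    _ ≤ _ := Finset.card_image_le
    _ = 4 * (I.card * (I.card * I.card)) := by simp
    _ ≤ 4 * ((3 * k) * ((3 * k) * (3 * k))) := by gcongr
    _ = 108 * k ^ 3 := by ring

theorem exists_base_digits {k x : ℕ} (hx : x < k ^ 4) : ∃ a b c d : ℤ,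
    a ∈ Icc (0 : ℤ) (k - 1) ∧ b ∈ Icc (0 : ℤ) (k - 1) ∧ c ∈ Icc (0 : ℤ) (k - 1) ∧
      d ∈ Icc (0 : ℤ) (k - 1) ∧ (x : ℝ) = a + b * k + c * k ^ 2 + d * k ^ 3 := by
  have hk : 0 < k := Nat.pos_of_ne_zero fun h => by simp [h] at hx
  have hmod : ∀ y : ℕ, ((y % k : ℕ) : ℤ) ∈ Icc (0 : ℤ) (k - 1) := fun y => by
    have := Nat.mod_lt y hk
    exact ⟨by positivity, by omega⟩
  have h3 : x / k / k / k < k := by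
    rw [Nat.div_div_eq_div_mul, Nat.div_div_eq_div_mul]
    exact Nat.div_lt_of_lt_mul (hx.trans_eq (by ring))
  refine ⟨((x % k : ℕ) : ℤ), ((x / k % k : ℕ) : ℤ), ((x / k / k % k : ℕ) : ℤ),
    ((x / k / k / k : ℕ) : ℤ), hmod _, hmod _, hmod _, ⟨by positivity, by omega⟩, ?_⟩
  have e : x = x % k + x / k % k * k + x / k / k % k * k ^ 2 + x / k / k / k * k ^ 3 := by
    calc x = k * (k * (k * (x / k / k / k) + x / k / k % k) + x / k % k) + x % k := by
          rw [Nat.div_add_mod, Nat.div_add_mod, Nat.div_add_mod]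
      _ = _ := by ring
  push_cast
  exact_mod_cast e

/-- A multiple of `k` has units digit zero. These elements, spaced `k` apart, serve as separated
digits for the lower bound. -/
theorem mul_mem_digitSet {k q : ℕ} (hq : q < k ^ 3) : (k : ℝ) * q ∈ digitSet k := by
  have hk : 0 < k := Nat.pos_of_ne_zero fun h => by simp [h] at hq
  have hx : k * q < k ^ 4 := by
    rw [pow_succ']; exact Nat.mul_lt_mul_of_pos_left hq hk
  obtain ⟨a, b, c, d, ha, hb, hc, hd, e⟩ := exists_base_digits hx
  have ha0 : a = 0 := by
    have e' : (k : ℤ) * q = a + b * k + c * k ^ 2 + d * k ^ 3 := by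
      push_cast at e; exact_mod_cast e
    have hdvd : (k : ℤ) ∣ a := by
      refine ⟨q - b - c * k - d * k ^ 2, ?_⟩
      linear_combination -e'
    exact Int.eq_zero_of_dvd_of_nonneg_of_lt ha.1 (by have := ha.2; omega) hdvd
  subst ha0
  have hbig : ∀ f : ℤ, f ∈ Icc (0 : ℤ) (k - 1) → f ∈ Icc (-(k : ℤ) + 1) (2 * k - 2) :=
    fun f hf => ⟨by have := hf.1; omega, by have := hf.2; omega⟩
  refine ⟨0, b, c, d, hbig _ ⟨le_rfl, by omega⟩, hbig _ hb, hbig _ hc, hbig _ hd, by simp, ?_⟩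
  rw [← e]; push_cast; ring

/-- `r` is a common radius of the digits `x` and `y` for the digit set `digitSet k`. -/
def IsDigitRadius (k : ℕ) (x y r : ℝ) : Prop :=
  x - r ∈ digitSet k ∧ x + r ∈ digitSet k ∧ y - r ∈ digitSet k ∧ y + r ∈ digitSet k

/-- The coefficient range of `digitSet` is exactly that of a base `k` digit minus a signed digit; no
carries are made, so a vanishing coefficient survives. -/
theorem sub_mem_digitSet {k : ℕ} {a b c d a' b' c' d' : ℤ}
    (ha : a ∈ Icc (0 : ℤ) (k - 1)) (hb : b ∈ Icc (0 : ℤ) (k - 1)) (hc : c ∈ Icc (0 : ℤ) (k - 1))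
    (hd : d ∈ Icc (0 : ℤ) (k - 1)) (ha' : |a'| ≤ k - 1) (hb' : |b'| ≤ k - 1) (hc' : |c'| ≤ k - 1)
    (hd' : |d'| ≤ k - 1) (h0 : (a - a') * (b - b') * (c - c') * (d - d') = 0) :
    ((a : ℝ) + b * k + c * k ^ 2 + d * k ^ 3) - (a' + b' * k + c' * k ^ 2 + d' * k ^ 3)
      ∈ digitSet k := by
  have key : ∀ e e' : ℤ, e ∈ Icc (0 : ℤ) (k - 1) → |e'| ≤ k - 1 →
      e - e' ∈ Icc (-(k : ℤ) + 1) (2 * k - 2) := by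
    intro e e' he he'
    rw [abs_le] at he'
    obtain ⟨h1, h2⟩ := he
    exact ⟨by omega, by omega⟩
  refine ⟨a - a', b - b', c - c', d - d', key _ _ ha ha', key _ _ hb hb', key _ _ hc hc',
    key _ _ hd hd', h0, ?_⟩
  push_cast
  ring

theorem isDigitRadius_of_digits {k : ℕ} {a b c d a₁ b₁ c₁ d₁ a' b' c' d' : ℤ}
    (ha : a ∈ Icc (0 : ℤ) (k - 1)) (hb : b ∈ Icc (0 : ℤ) (k - 1)) (hc : c ∈ Icc (0 : ℤ) (k - 1))
    (hd : d ∈ Icc (0 : ℤ) (k - 1)) (ha₁ : a₁ ∈ Icc (0 : ℤ) (k - 1))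
    (hb₁ : b₁ ∈ Icc (0 : ℤ) (k - 1)) (hc₁ : c₁ ∈ Icc (0 : ℤ) (k - 1))
    (hd₁ : d₁ ∈ Icc (0 : ℤ) (k - 1)) (ha' : |a'| ≤ k - 1) (hb' : |b'| ≤ k - 1)
    (hc' : |c'| ≤ k - 1) (hd' : |d'| ≤ k - 1)
    (h1 : (a - a') * (b - b') * (c - c') * (d - d') = 0)
    (h2 : (a + a') * (b + b') * (c + c') * (d + d') = 0)
    (h3 : (a₁ - a') * (b₁ - b') * (c₁ - c') * (d₁ - d') = 0)
    (h4 : (a₁ + a') * (b₁ + b') * (c₁ + c') * (d₁ + d') = 0) :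
    IsDigitRadius k (a + b * k + c * k ^ 2 + d * k ^ 3) (a₁ + b₁ * k + c₁ * k ^ 2 + d₁ * k ^ 3)
      (a' + b' * k + c' * k ^ 2 + d' * k ^ 3) := by
  refine ⟨sub_mem_digitSet ha hb hc hd ha' hb' hc' hd' h1, ?_,
    sub_mem_digitSet ha₁ hb₁ hc₁ hd₁ ha' hb' hc' hd' h3, ?_⟩
  · have := sub_mem_digitSet (a' := -a') (b' := -b') (c' := -c') (d' := -d') ha hb hc hd
      (by rwa [abs_neg]) (by rwa [abs_neg]) (by rwa [abs_neg]) (by rwa [abs_neg])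
      (by simpa only [sub_neg_eq_add] using h2)
    convert this using 1
    push_cast; ring
  · have := sub_mem_digitSet (a' := -a') (b' := -b') (c' := -c') (d' := -d') ha₁ hb₁ hc₁ hd₁
      (by rwa [abs_neg]) (by rwa [abs_neg]) (by rwa [abs_neg]) (by rwa [abs_neg])
      (by simpa only [sub_neg_eq_add] using h4)
    convert this using 1
    push_cast; ring

theorem abs_le_of_mem_digits {k : ℕ} {a : ℤ} (ha : a ∈ Icc (0 : ℤ) (k - 1)) : |a| ≤ k - 1 := by
  rw [abs_of_nonneg ha.1]; exact ha.2

theorem exists_isDigitRadius {k x y : ℕ} (hx : x < k ^ 4) (hy : y < k ^ 4) :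
    ∃ r : ℝ, IsDigitRadius k x y r := by
  obtain ⟨a, b, c, d, ha, hb, hc, hd, ex⟩ := exists_base_digits hx
  obtain ⟨a₁, b₁, c₁, d₁, ha₁, hb₁, hc₁, hd₁, ey⟩ := exists_base_digits hy
  rw [ex, ey]
  -- Each coefficient of `r` annihilates one coefficient of `x - r`, `x + r`, `y - r` and `y + r`,
  -- in this order.
  exact ⟨_, isDigitRadius_of_digits (a' := a) (b' := -b) (c' := c₁) (d' := -d₁)
    ha hb hc hd ha₁ hb₁ hc₁ hd₁ (abs_le_of_mem_digits ha)
    (by rw [abs_neg]; exact abs_le_of_mem_digits hb) (abs_le_of_mem_digits hc₁)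
    (by rw [abs_neg]; exact abs_le_of_mem_digits hd₁) (by ring) (by ring) (by ring) (by ring)⟩

/-- Exchanging the roles of `x - r` and `x + r` replaces `a - b k` by `b k - a`, a different number
unless `a = b = 0`. In that case `a' = 0` already serves both `x - r` and `x + r`, and `b'` is free.
-/
theorem exists_two_isDigitRadius {k x y : ℕ} (hk : 2 ≤ k) (hx : x < k ^ 4) (hy : y < k ^ 4) :
    ∃ r r' : ℝ, r ≠ r' ∧ IsDigitRadius k x y r ∧ IsDigitRadius k x y r' := by
  obtain ⟨a, b, c, d, ha, hb, hc, hd, ex⟩ := exists_base_digits hx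
  obtain ⟨a₁, b₁, c₁, d₁, ha₁, hb₁, hc₁, hd₁, ey⟩ := exists_base_digits hy
  rw [ex, ey]
  by_cases hab : a = 0 ∧ b = 0
  · obtain ⟨rfl, rfl⟩ := hab
    refine ⟨_, _, ?_, isDigitRadius_of_digits (a' := 0) (b' := 0) (c' := c₁) (d' := -d₁)
      ha hb hc hd ha₁ hb₁ hc₁ hd₁ (by simp; omega) (by simp; omega) (abs_le_of_mem_digits hc₁)
      (by rw [abs_neg]; exact abs_le_of_mem_digits hd₁) (by ring) (by ring) (by ring) (by ring),
      isDigitRadius_of_digits (a' := 0) (b' := 1) (c' := c₁) (d' := -d₁)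
      ha hb hc hd ha₁ hb₁ hc₁ hd₁ (by simp; omega) (by simp; omega) (abs_le_of_mem_digits hc₁)
      (by rw [abs_neg]; exact abs_le_of_mem_digits hd₁) (by ring) (by ring) (by ring) (by ring)⟩
    have : (k : ℝ) ≠ 0 := by positivity
    intro h
    apply this
    push_cast at h
    linarith
  · refine ⟨_, _, ?_, isDigitRadius_of_digits (a' := a) (b' := -b) (c' := c₁) (d' := -d₁)
      ha hb hc hd ha₁ hb₁ hc₁ hd₁ (abs_le_of_mem_digits ha)
      (by rw [abs_neg]; exact abs_le_of_mem_digits hb) (abs_le_of_mem_digits hc₁)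
      (by rw [abs_neg]; exact abs_le_of_mem_digits hd₁) (by ring) (by ring) (by ring) (by ring),
      isDigitRadius_of_digits (a' := -a) (b' := b) (c' := c₁) (d' := -d₁)
      ha hb hc hd ha₁ hb₁ hc₁ hd₁ (by rw [abs_neg]; exact abs_le_of_mem_digits ha)
      (abs_le_of_mem_digits hb) (abs_le_of_mem_digits hc₁)
      (by rw [abs_neg]; exact abs_le_of_mem_digits hd₁) (by ring) (by ring) (by ring) (by ring)⟩
    intro h
    have h1 : (a : ℝ) = b * k := by
      push_cast at h
      linarith
    have h2 : a = b * k := by exact_mod_cast h1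
    have h3 : a = 0 := Int.eq_zero_of_dvd_of_nonneg_of_lt ha.1 (by have := ha.2; omega)
      (Dvd.intro_left b h2.symm)
    rw [h3] at h2
    rcases mul_eq_zero.1 h2.symm with h4 | h4
    · exact hab ⟨h3, h4⟩
    · omega

theorem IsDigitRadius.abs_le {k x y : ℕ} (hk : 1 ≤ k) (hx : x < k ^ 4) {r : ℝ}
    (h : IsDigitRadius k x y r) : |r| ≤ 3 * (k : ℝ) ^ 4 := by
  have h1 := abs_le_of_mem_digitSet hk h.1
  have h2 : |(x : ℝ)| ≤ (k : ℝ) ^ 4 := by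
    rw [Nat.abs_cast]; exact_mod_cast hx.le
  have h3 := abs_sub_abs_le_abs_sub r x
  rw [abs_sub_comm] at h3
  linarith

end Digits

/-! ### Radii for sums, assembled from the digits. -/

section Radius

variable {t : ℕ → ℝ}

/-- The sums `∑ t i * x i` with natural numbers `x i < (i + 1) ^ 4`. -/
def centerSet (t : ℕ → ℝ) : Set ℝ :=
  infiniteSumset fun i => (fun x => t i * x) ''
    (((Finset.range ((i + 1) ^ 4)).image (Nat.cast : ℕ → ℝ) : Finset ℝ) : Set ℝ)

/-- The sums `∑ t i * x i` with `x i ∈ digitSet (i + 1)`. -/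
def vertexSet (t : ℕ → ℝ) : Set ℝ :=
  infiniteSumset fun i => (fun x => t i * x) '' digitSet (i + 1)

theorem mem_centerSet {x : ℝ} : x ∈ centerSet t ↔
    ∃ q : ℕ → ℕ, (∀ i, q i < (i + 1) ^ 4) ∧ HasSum (fun i => t i * q i) x := by
  rw [centerSet, mem_infiniteSumset_image]
  constructor
  · rintro ⟨q, hq, hx⟩
    simp only [Finset.coe_image, Finset.coe_range, mem_image, mem_Iio] at hq
    choose p hp hpq using hq
    exact ⟨p, hp, by simpa only [hpq] using hx⟩
  · rintro ⟨q, hq, hx⟩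
    exact ⟨fun i => q i, fun i => by simpa using hq i, hx⟩

theorem hasCommonRadius_of_ne_zero {A : Set ℝ} {p : Plane} {r : ℝ} (hr : r ≠ 0)
    (h : p 0 - r ∈ A ∧ p 0 + r ∈ A ∧ p 1 - r ∈ A ∧ p 1 + r ∈ A) : HasCommonRadius A p := by
  obtain ⟨h1, h2, h3, h4⟩ := h
  rcases lt_or_gt_of_ne hr with h0 | h0
  · exact ⟨-r, by linarith, by rwa [sub_neg_eq_add], by rwa [← sub_eq_add_neg],
      by rwa [sub_neg_eq_add], by rwa [← sub_eq_add_neg]⟩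
  · exact ⟨r, h0, h1, h2, h3, h4⟩

theorem HasCommonRadius.isCenterOfSquareIn {A : Set ℝ} {p : Plane} (h : HasCommonRadius A p) :
    IsCenterOfSquareIn (planeProd A A) p := by
  obtain ⟨r, hr, h1, h2, h3, h4⟩ := h
  exact ⟨r, hr, ⟨by simpa using h1, by simpa using h3⟩, ⟨by simpa using h2, by simpa using h3⟩,
    ⟨by simpa using h1, by simpa using h4⟩, ⟨by simpa using h2, by simpa using h4⟩⟩

theorem hasCommonRadius_of_mem_centerSet (ht : ∀ i, 0 < t i)
    (hstep : ∀ i, t (i + 1) * ((i : ℝ) + 2) ^ 4 ≤ t i) {p : Plane}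
    (hp : p ∈ planeProd (centerSet t) (centerSet t)) : HasCommonRadius (vertexSet t) p := by
  obtain ⟨x, hx, hx'⟩ := mem_centerSet.1 hp.1
  obtain ⟨y, hy, hy'⟩ := mem_centerSet.1 hp.2
  have hsum : ∀ r : ℕ → ℝ, (∀ i, IsDigitRadius (i + 1) (x i) (y i) (r i)) →
      Summable fun i => t i * r i := by
    intro r hr
    refine summable_scaled_digits ht hstep (c := 3) fun i => ?_
    have := (hr i).abs_le (Nat.succ_pos i) (hx i)
    push_cast at this
    exact this
  have hmem : ∀ (r : ℕ → ℝ) (R : ℝ), (∀ i, IsDigitRadius (i + 1) (x i) (y i) (r i)) →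
      HasSum (fun i => t i * r i) R → p 0 - R ∈ vertexSet t ∧ p 0 + R ∈ vertexSet t ∧
        p 1 - R ∈ vertexSet t ∧ p 1 + R ∈ vertexSet t := by
    intro r R hr hR
    refine ⟨mem_infiniteSumset_image.2 ⟨_, fun i => (hr i).1, ?_⟩,
      mem_infiniteSumset_image.2 ⟨_, fun i => (hr i).2.1, ?_⟩,
      mem_infiniteSumset_image.2 ⟨_, fun i => (hr i).2.2.1, ?_⟩,
      mem_infiniteSumset_image.2 ⟨_, fun i => (hr i).2.2.2, ?_⟩⟩
    · simpa only [mul_sub] using hx'.sub hR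
    · simpa only [mul_add] using hx'.add hR
    · simpa only [mul_sub] using hy'.sub hR
    · simpa only [mul_add] using hy'.add hR
  choose r hr using fun i => exists_isDigitRadius (hx i) (hy i)
  -- Index `1` is the first with a choice, since `digitSet 1` is `{0}`. The two resulting radii
  -- differ by `t 1 * (a - b)`, so they cannot both vanish.
  obtain ⟨a, b, hab, ha, hb⟩ := exists_two_isDigitRadius (k := 1 + 1) le_rfl (hx 1) (hy 1)
  have hupd : ∀ c, IsDigitRadius (1 + 1) (x 1) (y 1) c →
      ∀ i, IsDigitRadius (i + 1) (x i) (y i) (Function.update r 1 c i) := by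
    intro c hc i
    rcases eq_or_ne i 1 with rfl | hi
    · rwa [Function.update_self]
    · rw [Function.update_of_ne hi]; exact hr i
  have hA := (hsum _ (hupd a ha)).hasSum
  have hB := (hsum _ (hupd b hb)).hasSum
  by_cases h0 : ∑' i, t i * Function.update r 1 a i = 0
  · refine hasCommonRadius_of_ne_zero ?_ (hmem _ _ (hupd b hb) hB)
    intro h1
    rw [h0] at hA
    rw [h1] at hB
    have hdiff := hA.sub hB
    rw [sub_zero] at hdiff
    have hsingle := hasSum_single (f := fun i => t i * Function.update r 1 a i
      - t i * Function.update r 1 b i) 1 fun i hi => by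
        simp [Function.update_of_ne hi]
    have := hdiff.unique hsingle
    simp only [Function.update_self, ← mul_sub] at this
    rcases mul_eq_zero.1 this.symm with h2 | h2
    · exact (ht 1).ne' h2
    · exact hab (sub_eq_zero.1 h2)
  · exact hasCommonRadius_of_ne_zero h0 (hmem _ _ (hupd a ha) hA)

end Radius

/-! ### The sets of centers and of vertices. -/

section Sets

variable {σ : ℝ}

theorem isCompact_planeProd {A₁ A₂ : Set ℝ} (h₁ : IsCompact A₁) (h₂ : IsCompact A₂) :
    IsCompact (planeProd A₁ A₂) := by
  have hc : Continuous fun c : ℝ × ℝ => (!₂[c.1, c.2] : Plane) := by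
    refine (PiLp.continuous_toLp 2 _).comp (continuous_pi fun i => ?_)
    fin_cases i
    · exact continuous_fst
    · exact continuous_snd
  convert (h₁.prod h₂).image hc using 1
  ext p
  constructor
  · rintro ⟨h0, h1⟩
    refine ⟨(p 0, p 1), ⟨h0, h1⟩, ?_⟩
    ext i
    fin_cases i <;> simp
  · rintro ⟨c, hc, rfl⟩
    exact ⟨by simpa using hc.1, by simpa using hc.2⟩

theorem isDigitSumset_vertexSet (hσ : σ ≤ 1) : IsDigitSumset (vertexSet (scale σ)) :=
  ⟨scale σ, scale_pos σ, summable_scale_mul (scale_pos σ) (scale_step hσ), rfl⟩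

theorem centerDigit_abs_le (i : ℕ) : ∀ x ∈ (Finset.range ((i + 1) ^ 4)).image (Nat.cast : ℕ → ℝ),
    |x| ≤ 2 * ((i : ℝ) + 1) ^ 4 := by
  intro x hx
  obtain ⟨q, hq, rfl⟩ := Finset.mem_image.1 hx
  have h1 : (q : ℝ) ≤ ((i : ℝ) + 1) ^ 4 := by exact_mod_cast (Finset.mem_range.1 hq).le
  have h2 : (0 : ℝ) ≤ ((i : ℝ) + 1) ^ 4 := by positivity
  rw [Nat.abs_cast]; linarith

theorem isCompact_centerSet (hσ : σ ≤ 1) : IsCompact (centerSet (scale σ)) :=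
  isCompact_infiniteSumset (scale_pos σ) (scale_step hσ) centerDigit_abs_le

theorem exists_finset_vertexDigits : ∃ W : ℕ → Finset ℝ, (∀ i, (W i).card ≤ 108 * (i + 1) ^ 3) ∧
    (∀ i, (W i : Set ℝ) = digitSet (i + 1)) ∧ ∀ i, ∀ x ∈ W i, |x| ≤ 2 * ((i : ℝ) + 1) ^ 4 := by
  choose W hW hW' using fun i : ℕ => exists_finset_digitSet (Nat.succ_pos i)
  refine ⟨W, hW, hW', fun i x hx => ?_⟩
  have := abs_le_of_mem_digitSet (Nat.succ_pos i) (x := x) (by rw [← hW']; exact hx)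
  push_cast at this
  exact this

theorem isCompact_vertexSet (hσ : σ ≤ 1) : IsCompact (vertexSet (scale σ)) := by
  obtain ⟨W, -, hW, hWb⟩ := exists_finset_vertexDigits
  have := isCompact_infiniteSumset (scale_pos σ) (scale_step hσ) hWb
  simp only [hW] at this
  exact this

theorem centerSet_dimensions (hσ0 : 0 ≤ σ) (hσ : σ ≤ 1) :
    dimH (planeProd (centerSet (scale σ)) (centerSet (scale σ))) = ENNReal.ofReal (2 * σ) ∧
      HasBoxDim (planeProd (centerSet (scale σ)) (centerSet (scale σ))) (2 * σ) ∧
      packingDim (planeProd (centerSet (scale σ)) (centerSet (scale σ)))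
        = ENNReal.ofReal (2 * σ) := by
  have := (infiniteSumset_dimensions hσ0 hσ (C := 1) (m := 4) le_rfl (by norm_num)
    (W := fun i => (Finset.range ((i + 1) ^ 4)).image (Nat.cast : ℕ → ℝ))
    (fun i => Finset.card_image_le.trans (by simp)) centerDigit_abs_le
    -- Consecutive digits lack the extra unit of separation, so only the even ones are kept.
    (n := fun i => ((i + 1) ^ 4 + 1) / 2) (d := fun i q => 2 * (q : ℝ)) ?_ ?_ ?_ ?_ ?_
    (E := centerSet (scale σ)) rfl).2
  · rwa [show 2 * (((4 : ℕ) : ℝ) * σ / 4) = 2 * σ by push_cast; ring] at this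
  · intro i; omega
  · intro i
    have : 2 ^ 4 ≤ (i + 1 + 1) ^ 4 := Nat.pow_le_pow_left (by omega) 4
    omega
  · intro i q hq
    exact Finset.mem_image.2 ⟨2 * q, Finset.mem_range.2 (by omega), by push_cast; ring⟩
  · intro i q hq
    have h1 : 2 * q + 1 ≤ (i + 1) ^ 4 := by omega
    have h2 : 2 * (q : ℝ) + 1 ≤ ((i : ℝ) + 1) ^ 4 := by exact_mod_cast h1
    exact ⟨by positivity, by linarith⟩
  · intro i q q' _ _ hne
    have h1 : (1 : ℝ) ≤ |(q : ℝ) - q'| := by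
      have : (1 : ℤ) ≤ |(q : ℤ) - q'| := Int.one_le_abs (by omega)
      exact_mod_cast this
    rw [← mul_sub, abs_mul, abs_two]
    linarith

theorem vertexSet_dimensions (hσ0 : 0 ≤ σ) (hσ : σ ≤ 1) :
    (HasBoxDim (vertexSet (scale σ)) (3 * σ / 4) ∧
      packingDim (vertexSet (scale σ)) = ENNReal.ofReal (3 * σ / 4)) ∧
    HasBoxDim (planeProd (vertexSet (scale σ)) (vertexSet (scale σ))) (3 * σ / 2) ∧
      packingDim (planeProd (vertexSet (scale σ)) (vertexSet (scale σ)))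
        = ENNReal.ofReal (3 * σ / 2) := by
  obtain ⟨W, hcard, hW, hWb⟩ := exists_finset_vertexDigits
  have := (infiniteSumset_dimensions hσ0 hσ (C := 108) (m := 3) (by norm_num) (by norm_num)
    hcard hWb (n := fun i => (i + 1) ^ 3) (d := fun i q => ((i : ℝ) + 1) * (q : ℝ)) ?_ ?_ ?_ ?_ ?_
    (E := vertexSet (scale σ)) (by simp only [hW]; rfl))
  · rw [show 2 * (((3 : ℕ) : ℝ) * σ / 4) = 3 * σ / 2 by push_cast; ring,
      show ((3 : ℕ) : ℝ) * σ / 4 = 3 * σ / 4 by push_cast; ring] at this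
    exact ⟨this.1.2, this.2.2⟩
  · intro i; omega
  · intro i
    have : 2 ^ 3 ≤ (i + 1 + 1) ^ 3 := Nat.pow_le_pow_left (by omega) 3
    omega
  · intro i q hq
    have := mul_mem_digitSet hq
    rw [← hW] at this
    push_cast at this
    exact this
  · intro i q hq
    have h1 : (q : ℝ) + 1 ≤ ((i : ℝ) + 1) ^ 3 := by exact_mod_cast hq
    have h2 : (0 : ℝ) ≤ i := Nat.cast_nonneg _
    have h3 := mul_le_mul_of_nonneg_left h1 (show (0 : ℝ) ≤ (i : ℝ) + 1 by positivity)
    exact ⟨by positivity, by nlinarith⟩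
  · intro i q q' hq hq' hne
    have h1 : (1 : ℝ) ≤ |(q : ℝ) - q'| := by
      have : (1 : ℤ) ≤ |(q : ℤ) - q'| := Int.one_le_abs (by omega)
      exact_mod_cast this
    -- At `i = 0` there is only one digit; from `i = 1` on, the spacing `i + 1` is at least `2`, as
    -- separation requires.
    have hi : 1 ≤ i := by
      rcases Nat.eq_zero_or_pos i with rfl | h
      · simp at hq hq'; omega
      · exact h
    have h2 : (1 : ℝ) ≤ i := by exact_mod_cast hi
    rw [← mul_sub, abs_mul, abs_of_pos (show (0 : ℝ) < (i : ℝ) + 1 by positivity)]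
    nlinarith

/-- For `σ = 1` every weight is `1`, so the scale is `1 / ((i + 1)!) ^ 4`, the reciprocal place
value for the bases `(i + 1) ^ 4`. -/
theorem Icc_subset_centerSet : Icc 0 1 ⊆ centerSet (scale 1) := by
  intro y hy
  obtain ⟨q, hq, hqy⟩ := exists_mixedRadix_expansion_Icc (n := fun i => (i + 1) ^ 4)
    (fun i => Nat.one_le_pow _ _ (Nat.succ_pos i))
    (fun i => by
      have : 2 ^ 4 ≤ (i + 1 + 1) ^ 4 := Nat.pow_le_pow_left (by omega) 4
      omega) hy
  refine mem_centerSet.2 ⟨q, hq, ?_⟩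
  have hpv : ∀ i, placeValue (fun i => (i + 1) ^ 4) i = i.factorial ^ 4 := by
    intro i
    induction i with
    | zero => simp [placeValue]
    | succ i ih => rw [placeValue_succ, ih, Nat.factorial_succ]; ring
  convert hqy using 2 with i
  have hw : scaleWeight 1 i = 1 :=
    max_eq_left ((div_le_one (by positivity)).2 (by linarith [Nat.cast_nonneg (α := ℝ) i]))
  rw [hpv, scale, hw, div_one, Real.rpow_neg (by positivity), div_eq_mul_inv, mul_comm,
    show (4 : ℝ) = ((4 : ℕ) : ℝ) by norm_num, Real.rpow_natCast]
  push_cast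
  rfl

end Sets

/-! ### The theorem, with `σ = s / 2` in (a) and (c) and `σ = 1` in (b) and (d). -/

theorem theorem5p2 :
    (∀ s : ℝ, 0 ≤ s → s ≤ 2 → ∃ S B : Set Plane, IsCompact S ∧ IsCompact B ∧
      dimH S = ENNReal.ofReal s ∧ HasBoxDim S s ∧ packingDim S = ENNReal.ofReal s ∧
      packingDim B = ENNReal.ofReal (3 * s / 4) ∧ HasBoxDim B (3 * s / 4) ∧
      (∀ p ∈ S, IsCenterOfSquareIn B p) ∧
      ∃ A : Set ℝ, IsDigitSumset A ∧ B = planeProd A A) ∧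
    (∃ B : Set Plane, IsCompact B ∧
      packingDim B = ENNReal.ofReal (3 / 2) ∧ HasBoxDim B (3 / 2) ∧
      (∀ p ∈ planeProd (Set.Icc 0 1) (Set.Icc 0 1), IsCenterOfSquareIn B p) ∧
      ∃ A : Set ℝ, IsDigitSumset A ∧ B = planeProd A A) ∧
    (∀ s : ℝ, 0 ≤ s → s ≤ 2 → ∃ (A : Set ℝ) (S : Set Plane), IsCompact A ∧ IsCompact S ∧
      dimH S = ENNReal.ofReal s ∧ HasBoxDim S s ∧ packingDim S = ENNReal.ofReal s ∧
      HasBoxDim A (3 * s / 8) ∧ packingDim A = ENNReal.ofReal (3 * s / 8) ∧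
      (∀ p ∈ S, HasCommonRadius A p) ∧ IsDigitSumset A) ∧
    (∃ A : Set ℝ, IsCompact A ∧
      HasBoxDim A (3 / 4) ∧ packingDim A = ENNReal.ofReal (3 / 4) ∧
      (∀ p ∈ planeProd (Set.Icc 0 1) (Set.Icc 0 1), HasCommonRadius A p) ∧ IsDigitSumset A) := by
  refine ⟨fun s hs0 hs2 => ?_, ?_, fun s hs0 hs2 => ?_, ?_⟩
  · have h0 : 0 ≤ s / 2 := by linarith
    have h1 : s / 2 ≤ 1 := by linarith
    have hA := isCompact_vertexSet h1
    have hC := isCompact_centerSet h1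
    have hS := centerSet_dimensions h0 h1
    have hB := (vertexSet_dimensions h0 h1).2
    rw [show 2 * (s / 2) = s by ring] at hS
    rw [show 3 * (s / 2) / 2 = 3 * s / 4 by ring] at hB
    exact ⟨_, _, isCompact_planeProd hC hC, isCompact_planeProd hA hA, hS.1, hS.2.1, hS.2.2,
      hB.2, hB.1, fun p hp => (hasCommonRadius_of_mem_centerSet (scale_pos _) (scale_step h1)
        hp).isCenterOfSquareIn, _, isDigitSumset_vertexSet h1, rfl⟩
  · have hA := isCompact_vertexSet (le_refl (1 : ℝ))
    have hB := (vertexSet_dimensions zero_le_one le_rfl).2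
    rw [mul_one] at hB
    exact ⟨_, isCompact_planeProd hA hA, hB.2, hB.1,
      fun p hp => (hasCommonRadius_of_mem_centerSet (scale_pos _) (scale_step le_rfl)
        ⟨Icc_subset_centerSet hp.1, Icc_subset_centerSet hp.2⟩).isCenterOfSquareIn,
      _, isDigitSumset_vertexSet le_rfl, rfl⟩
  · have h0 : 0 ≤ s / 2 := by linarith
    have h1 : s / 2 ≤ 1 := by linarith
    have hC := isCompact_centerSet h1
    have hS := centerSet_dimensions h0 h1
    have hB := (vertexSet_dimensions h0 h1).1
    rw [show 2 * (s / 2) = s by ring] at hS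
    rw [show 3 * (s / 2) / 4 = 3 * s / 8 by ring] at hB
    exact ⟨_, _, isCompact_vertexSet h1, isCompact_planeProd hC hC, hS.1, hS.2.1, hS.2.2,
      hB.1, hB.2, fun p hp => hasCommonRadius_of_mem_centerSet (scale_pos _) (scale_step h1) hp,
      isDigitSumset_vertexSet h1⟩
  · have hB := (vertexSet_dimensions zero_le_one le_rfl).1
    rw [mul_one] at hB
    exact ⟨_, isCompact_vertexSet le_rfl, hB.1, hB.2,
      fun p hp => hasCommonRadius_of_mem_centerSet (scale_pos _) (scale_step le_rfl)
        ⟨Icc_subset_centerSet hp.1, Icc_subset_centerSet hp.2⟩,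
      isDigitSumset_vertexSet le_rfl⟩
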